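/- **Notation.** For $n\ge 1$ let $P^+(n)$ be the largest prime factor of $n$, with $P^+(1)=1$; the letters $p,p_1,p_2,\dots$ denote primes. Let $\mathcal A$ be a finite non-empty set of positive integers, $y>1$ a real number, and $$x=\sup\mathcal A,\qquad u=\frac{\log x}{\log y},\qquad \Psi_{\mathcal A}(y)=\#\{n\in\mathcal A: P^+(n)\le y\},\qquad A_d=\#\{n\in\mathcal A: d\mid n\}.$$ Let $X,\kappa>0$ be real, let $\gamma$ be a real-valued multiplicative arithmetic function, and put $r_d=A_d-\frac{\gamma(d)}{d}X$. Consider the following conditions, in which $A,B,C,\delta$ and $C_k$ $(k\ge 1)$ are real constants with $\delta>0$, $\theta\in(0,1)$, and $a$ is a non-zero integer. * $(\mathrm A_\kappa)$: $\bigl|\sum_{p\le z}\frac{\log p}{p}\gamma(p)-\kappa\log z\bigr|\le A$ for all real $z\ge2$. * $(\mathrm B)$: $\gamma(p^\alpha)\le B$ for all primes $p$ and all $\alpha\ge1$. * $(\mathrm C_\theta)$: $\sum_{1\le d\le y^{u\theta}}|r_d|\le C\,X/(\log y)^{\delta}$. * $(\mathrm D_\theta)$: for every $k\ge1$ and every convex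 set $U\subset\{\mathbf s\in[0,1]^k: s_1+\dots+s_k\le u\theta\}$, $$\Bigl|\sum_{\substack{(\frac{\log p_1}{\log y},\dots,\frac{\log p_k}{\log y})\in U\\ (a,p_j)=1\ (1\le j\le k)}} r_{p_1\cdots p_k}\Bigr|\le C_k\,\frac{X}{(\log y)^{\delta}}.$$ **The coefficient.** For $u\ge1$ and $0\le v<1$ put $\mu_1(u,v)=\frac1u\,\mathrm{meas}\bigl((0,1)\cap(u-1,u-v)\bigr)$ and, for $k\ge2$, $$\mu_k(u,v)=\frac1u\int_{V_k(u,v)}\ \prod_{i=1}^{k-1}\frac{1}{u-t_1-\cdots-t_i}\,d\mathbf t,$$ $$V_k(u,v)=\{\mathbf t\in(0,1)^k: t_1+\cdots+t_{k-1}<u-1<t_1+\cdots+t_k<u-v\}.$$ Put $\mu^{(\kappa)}(u,v)=\sum_{k\ge1}\kappa^k\mu_k(u,v)$ and $\varrho_{\theta,\kappa}(u)=\mu^{(\kappa)}(u,(1-\theta)u)$. Let $\varrho$ be the Dickman function: the continuous function on $[0,\infty)$ with $\varrho=1$ on $[0,1]$, differentiable on $(1,\infty)$, with $u\varrho'(u)+\varrho(u-1)=0$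 for $u>1$. **Theorem.** Let $\kappa>0$. 1. If $u\ge1$, $\theta\in(0,1)$ and $(1-\theta)u<1$, then the series defining $\varrho_{\theta,\kappa}(u)$ converges and $\varrho_{\theta,\kappa}(u)>0$. 2. Let $A,B,C,u_0$ be real numbers, $\delta>0$ and $\varepsilon>0$. There is $x_0$, depending only on $\kappa,A,B,C,\delta,u_0,\varepsilon$, such that, for all $\mathcal A,\gamma,X,y,\theta$ as above satisfying $x\ge x_0$, $1\le u\le u_0$, $(1-\theta)u<1$, $(\mathrm A_\kappa)$, $(\mathrm B)$ and $(\mathrm C_\theta)$ with these constants, $$\Psi_{\mathcal A}(y)\ \ge\ \bigl(\varrho_{\theta,\kappa}(u)-\varepsilon\bigr)\,\#\mathcal A .$$ In other words, $\Psi_{\mathcal A}(y)\ge\{\varrho_{\theta,\kappa}(u)+o(1)\}\#\mathcal A$ as $x\to\infty$, uniformly for bounded $u$. 3. The same lower bound holds if $(\mathrm C_\theta)$ is replaced by $(\mathrm D_\theta)$ together with $X\sim\#\mathcal A$. Precisely: let $A,B,u_0$ be real numbers, $\delta>0$, $\varepsilon>0$, $a$ a non-zero integer, $(C_k)_{k\ge1}$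 a real sequence, and $\eta:\mathbb R\to\mathbb R$ a function with $\eta(t)\to0$ as $t\to\infty$. There is $x_0$, depending only on $\kappa$ and these data, such that the displayed inequality holds for all $\mathcal A,\gamma,X,y,\theta$ as above satisfying $x\ge x_0$, $1\le u\le u_0$, $(1-\theta)u<1$, $(\mathrm A_\kappa)$, $(\mathrm B)$, $(\mathrm D_\theta)$ and $|\#\mathcal A-X|\le\eta(x)X$. 4. For every $u\ge1$, $\varrho_{\theta,1}(u)\to\varrho(u)$ as $\theta\to1^-$. -/

import Mathlib

open Filter Topology MeasureTheory

namespace Friable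

/-- The largest prime factor `P⁺(n)`, with the convention `P⁺(1) = 1`. -/
def largestPrimeFactor (n : ℕ) : ℕ := max 1 (n.primeFactors.sup id)

/-- `Ψ_𝒜(y)`: the number of `y`-friable elements of `𝒜`. -/
noncomputable def friableCount (𝒜 : Finset ℕ) (y : ℝ) : ℕ :=
  (𝒜.filter fun n => (largestPrimeFactor n : ℝ) ≤ y).card

/-- `x = sup 𝒜`. -/
noncomputable def supElt (𝒜 : Finset ℕ) : ℝ := ((𝒜.sup id : ℕ) : ℝ)

/-- `u = log x / log y`, where `x = sup 𝒜`. -/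
noncomputable def uParam (𝒜 : Finset ℕ) (y : ℝ) : ℝ := Real.log (supElt 𝒜) / Real.log y

/-- `A_d`: the number of elements of `𝒜` divisible by `d`. -/
def multCount (𝒜 : Finset ℕ) (d : ℕ) : ℕ := (𝒜.filter fun n => d ∣ n).card

/-- `r_d = A_d - γ(d) X / d`. -/
noncomputable def remainder (𝒜 : Finset ℕ) (γ : ArithmeticFunction ℝ) (X : ℝ) (d : ℕ) : ℝ :=
  (multCount 𝒜 d : ℝ) - γ d / d * X

/-- Condition `(A_κ)`, with the constant `A`. -/
def CondA (γ : ArithmeticFunction ℝ) (κ A : ℝ) : Prop :=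
  ∀ z : ℝ, 2 ≤ z →
    |(∑ p ∈ (Finset.Icc 1 ⌊z⌋₊).filter Nat.Prime, Real.log p / p * γ p) - κ * Real.log z| ≤ A

/-- Condition `(B)`, with the constant `B`. -/
def CondB (γ : ArithmeticFunction ℝ) (B : ℝ) : Prop :=
  ∀ p : ℕ, p.Prime → ∀ α : ℕ, 1 ≤ α → γ (p ^ α) ≤ B

/-- Condition `(C_θ)`, with the exponent `δ` and the implied constant `C`. -/
def CondC (𝒜 : Finset ℕ) (γ : ArithmeticFunction ℝ) (X y θ δ C : ℝ) : Prop :=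
  ∑ d ∈ Finset.Icc 1 ⌊y ^ (uParam 𝒜 y * θ)⌋₊, |remainder 𝒜 γ X d| ≤ C * (X / Real.log y ^ δ)

/-- `𝒮(σ) = {s ∈ [0,1]^k : s₁ + ⋯ + s_k ≤ σ}`. -/
def simplexRegion (k : ℕ) (σ : ℝ) : Set (Fin k → ℝ) :=
  {s | (∀ i, s i ∈ Set.Icc (0 : ℝ) 1) ∧ ∑ i, s i ≤ σ}

open Classical in
/-- The sum of `r_{p₁⋯p_k}` over the `k`-tuples of primes `p₁, …, p_k`, all coprime to `a`, with
`(log p₁ / log y, …, log p_k / log y) ∈ U`. It is only used for `U ⊆ [0,1]^k`, where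
membership in `U` forces `p_j ≤ y`. -/
noncomputable def regionSum (𝒜 : Finset ℕ) (γ : ArithmeticFunction ℝ) (X y : ℝ) (a : ℤ) (k : ℕ)
    (U : Set (Fin k → ℝ)) : ℝ :=
  ∑ p ∈ (Fintype.piFinset fun _ : Fin k => (Finset.Icc 1 ⌊y⌋₊).filter Nat.Prime).filter
      (fun p => (fun j => Real.log (p j) / Real.log y) ∈ U ∧ ∀ j, Int.gcd a (p j) = 1),
    remainder 𝒜 γ X (∏ j, p j)

/-- Condition `(D_θ)` relative to the integer `a`, with the exponent `δ` and, for each `k`,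
the implied constant `C k`. -/
def CondD (𝒜 : Finset ℕ) (γ : ArithmeticFunction ℝ) (X y θ δ : ℝ) (a : ℤ) (C : ℕ → ℝ) : Prop :=
  ∀ k : ℕ, 1 ≤ k → ∀ U : Set (Fin k → ℝ), Convex ℝ U →
    U ⊆ simplexRegion k (uParam 𝒜 y * θ) →
      |regionSum 𝒜 γ X y a k U| ≤ C k * (X / Real.log y ^ δ)

/-- `f_k(u; t₁, …, t_k) = ∏ᵢ 1 / (u - t₁ - ⋯ - tᵢ)`. -/
noncomputable def fKernel (k : ℕ) (u : ℝ) (t : Fin k → ℝ) : ℝ :=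
  ∏ i, 1 / (u - ∑ j ∈ Finset.Iic i, t j)

/-- `V_{k+1}(u, v)`: the points `t` of `(0,1)^{k+1}` with
`t₁ + ⋯ + t_k < u - 1 < t₁ + ⋯ + t_{k+1} < u - v`. -/
def VRegion (k : ℕ) (u v : ℝ) : Set (Fin (k + 1) → ℝ) :=
  {t | (∀ i, t i ∈ Set.Ioo (0 : ℝ) 1) ∧ ∑ i : Fin k, t i.castSucc < u - 1 ∧
    u - 1 < ∑ i, t i ∧ ∑ i, t i < u - v}

/-- `μ_k(u, v)` for `k ≥ 1` (the value `0` at `k = 0` is never used). -/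
noncomputable def muK : ℕ → ℝ → ℝ → ℝ
  | 0, _, _ => 0
  | 1, u, v => 1 / u * (volume (Set.Ioo (0 : ℝ) 1 ∩ Set.Ioo (u - 1) (u - v))).toReal
  | k + 2, u, v =>
      1 / u * ∫ t in VRegion (k + 1) u v, fKernel (k + 1) u (fun i => t i.castSucc)

/-- `μ^{(κ)}(u, v) = ∑_{k ≥ 1} κ^k μ_k(u, v)`. -/
noncomputable def muSeries (κ u v : ℝ) : ℝ := ∑' k : ℕ, κ ^ (k + 1) * muK (k + 1) u v

/-- `ϱ_{θ,κ}(u) = μ^{(κ)}(u, (1 - θ) u)`. -/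
noncomputable def rhoTheta (θ κ u : ℝ) : ℝ := muSeries κ u ((1 - θ) * u)

/-- Successive approximations of the Dickman function, obtained by iterating
`ϱ(u) = 1 - ∫_1^u ϱ(t - 1) dt / t`; the `n`-th one is exact on `(-∞, n + 1]`. -/
noncomputable def dickmanApprox : ℕ → ℝ → ℝ
  | 0, _ => 1
  | n + 1, u => 1 - ∫ t in (1 : ℝ)..(max 1 u), dickmanApprox n (t - 1) / t

/-- The Dickman function `ϱ`. -/
noncomputable def dickman (u : ℝ) : ℝ := dickmanApprox ⌈u⌉₊ u

theorem dickmanApprox_succ_eq (n : ℕ) :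
    ∀ u : ℝ, u ≤ n + 1 → dickmanApprox (n + 1) u = dickmanApprox n u := by
  induction n with
  | zero =>
    intro u hu
    have h : max 1 u = 1 := max_eq_left (by simpa using hu)
    simp [dickmanApprox, h]
  | succ n ih =>
    intro u hu
    rw [dickmanApprox, dickmanApprox]
    congr 1
    apply intervalIntegral.integral_congr
    intro t ht
    rw [Set.uIcc_of_le (le_max_left _ _)] at ht
    have h1 : t - 1 ≤ n + 1 := by
      have := ht.2
      push_cast at hu
      rcases le_max_iff.1 this with h | h
      · have : (0 : ℝ) ≤ n := n.cast_nonneg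
        linarith
      · linarith
    simp only [ih _ h1]

theorem dickmanApprox_eq_of_le {n m : ℕ} (hnm : n ≤ m) {u : ℝ} (hu : u ≤ n + 1) :
    dickmanApprox m u = dickmanApprox n u := by
  induction m, hnm using Nat.le_induction with
  | base => rfl
  | succ m hm ih =>
    rw [dickmanApprox_succ_eq m u, ih]
    have : (n : ℝ) ≤ m := by exact_mod_cast hm
    linarith

theorem dickman_eq_approx {n : ℕ} {u : ℝ} (hu : u ≤ n + 1) : dickman u = dickmanApprox n u := by
  have h2 : u ≤ (⌈u⌉₊ : ℝ) + 1 := (Nat.le_ceil u).trans (by linarith)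
  rcases le_total n ⌈u⌉₊ with h | h
  · exact dickmanApprox_eq_of_le h hu
  · exact (dickmanApprox_eq_of_le h h2).symm

/-- The Dickman function is `1` on `[0,1]`. -/
theorem dickman_of_le_one {u : ℝ} (hu : u ≤ 1) : dickman u = 1 := by
  rw [dickman_eq_approx (n := 0) (by simpa using hu), dickmanApprox]

theorem continuous_dickmanApprox (n : ℕ) : Continuous (dickmanApprox n) := by
  induction n with
  | zero => exact continuous_const
  | succ n ih =>
    have h : dickmanApprox (n + 1) =
        fun u => 1 - ∫ t in (1 : ℝ)..(max 1 u), dickmanApprox n (t - 1) / (max 1 t) := by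
      funext u
      rw [dickmanApprox]
      congr 1
      apply intervalIntegral.integral_congr
      intro t ht
      rw [Set.uIcc_of_le (le_max_left _ _)] at ht
      simp only [max_eq_right ht.1]
    have hc : Continuous fun t : ℝ => dickmanApprox n (t - 1) / (max 1 t) := by
      refine Continuous.div (by fun_prop) (by fun_prop) fun t => ?_
      exact (lt_of_lt_of_le one_pos (le_max_left _ _)).ne'
    rw [h]
    exact continuous_const.sub
      ((intervalIntegral.continuous_primitive (fun a b => hc.intervalIntegrable a b) 1).comp
        (by fun_prop))

/-- The Dickman function is continuous. -/
theorem continuous_dickman : Continuous dickman := by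
  rw [continuous_iff_continuousAt]
  intro u
  refine (continuous_dickmanApprox ⌈u⌉₊).continuousAt.congr ?_
  have : u < (⌈u⌉₊ : ℝ) + 1 := (Nat.le_ceil u).trans_lt (by linarith)
  filter_upwards [Iio_mem_nhds this] with w hw
  exact (dickman_eq_approx (le_of_lt hw)).symm

/-- The Dickman function satisfies `u ϱ'(u) + ϱ(u - 1) = 0` for `u > 1`. -/
theorem hasDerivAt_dickman {u : ℝ} (hu : 1 < u) :
    HasDerivAt dickman (-(dickman (u - 1) / u)) u := by
  set n := ⌈u⌉₊
  have hn : u < (n : ℝ) + 1 := (Nat.le_ceil u).trans_lt (by linarith)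
  have hc : Continuous fun t : ℝ => dickmanApprox n (t - 1) / (max 1 t) := by
    refine Continuous.div ?_ (by fun_prop) fun t => ?_
    · exact (continuous_dickmanApprox n).comp (by fun_prop)
    · exact (lt_of_lt_of_le one_pos (le_max_left _ _)).ne'
  have hd := (intervalIntegral.integral_hasDerivAt_right (hc.intervalIntegrable 1 u)
    (hc.stronglyMeasurableAtFilter _ _) hc.continuousAt).const_sub 1
  simp only [max_eq_right hu.le] at hd
  rw [dickman_eq_approx (n := n) (u := u - 1) (by linarith)]
  refine hd.congr_of_eventuallyEq ?_
  filter_upwards [Iio_mem_nhds hn, Ioi_mem_nhds hu] with w hw hw1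
  rw [dickman_eq_approx (n := n + 1) (by push_cast; linarith [Set.mem_Iio.1 hw]), dickmanApprox,
    max_eq_right (le_of_lt hw1)]
  congr 1
  apply intervalIntegral.integral_congr
  intro t ht
  rw [Set.uIcc_of_le (le_of_lt hw1)] at ht
  simp only [max_eq_right ht.1]

end Friable

open Friable

/-! Friable integers are detected by a stick-breaking process on their prime factors. Given `n ≤ x =
y^u`, draw primes `p₁, p₂, …` in turn with `p₁⋯pᵢ ∣ n`. Writing `tᵢ = log pᵢ / log y`, the prime
`pᵢ` receives the weight `tᵢ / (u - t₁ - ⋯ - tᵢ₋₁)`. These weights sum to at most `1` at every step,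
because the primes dividing the cofactor `n / (p₁⋯pᵢ₋₁)` have total logarithm at most that of the
cofactor, hence at most `(u - t₁ - ⋯ - tᵢ₋₁) log y`. The process stops once `∑ tᵢ > u - 1`. The
cofactor is then below `y`, so if all the drawn primes are at most `y`, then `n` is `y`-friable.
Consequently the total weight of the stopping tuples of primes `≤ y` is a minorant of the indicator
of friability (`sum_weight_stop_le`, `largestPrimeFactor_le_of_stop`).

Summing the minorant over `𝒜` turns it into a weighted sum of `A_{p₁⋯p_k}`. Only tuples with `∑ tᵢ ≤
u - v`, `v = (1 - θ)u`, are kept, that is `p₁⋯p_k ≤ y^{uθ}`, the range controlled by the remainder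
hypotheses. The main term is `X ∏ γ(pᵢ)/pᵢ`. Under `(A_κ)` the measure `γ(p)/p` behaves like `κ
dt/t`, which cancels the numerators `tᵢ` and leaves `κ^k` times the integral of `stick`, namely `κ^k
μ_k(u, v)`.

To use remainder sums without weights, the cube is cut into cells of side `1/N` and the weight is
replaced by its value at the lower corner of each cell. A cell is a convex box, as `(D_θ)` requires;
distinct indices make the primes distinct, as multiplicativity and `(C_θ)` require. The
discretisation loss is uniform in `u, v` (`eventually_muK_sub_le`), and finitely many `k` suffice
because `μ_{k+1} ≤ (u-1)^k / k!`.

Conditioning on the first piece gives a recursion for `μ_k` (`muK_recursion`). It yields positivity,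
the factorial bound and, compared with `u ϱ(u) = ∫_{u-1}^u ϱ`, the limit `θ → 1`. -/

namespace Friable

/-! ### The stick-breaking density and the stopping region -/

/-- The product `∏ᵢ 1 / (u - t₁ - ⋯ - t_{i-1})` of stick-breaking densities. -/
noncomputable def stick (m : ℕ) (u : ℝ) (t : Fin m → ℝ) : ℝ :=
  ∏ i, (u - ∑ l, if l < i then t l else 0)⁻¹

theorem stick_castSucc (m : ℕ) (u : ℝ) (t : Fin (m + 1) → ℝ) :
    stick (m + 1) u t =
      stick m u (fun i => t i.castSucc) * (u - ∑ i : Fin m, t i.castSucc)⁻¹ := by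
  simp [stick, Fin.prod_univ_castSucc, Fin.sum_univ_castSucc, Fin.castSucc_lt_last,
    (Fin.castSucc_lt_last _).not_gt, mul_comm]

/-- Once the first piece `t` is removed, the process restarts on a stick of length `u - t`. This
self-similarity is the source of the recursion in `k`. -/
theorem stick_cons (m : ℕ) (u t : ℝ) (s : Fin m → ℝ) :
    stick (m + 1) u (Fin.cons t s) = u⁻¹ * stick m (u - t) s := by
  simp [stick, Fin.prod_univ_succ, Fin.sum_univ_succ, sub_sub, mul_comm]

theorem stick_eq_fKernel (m : ℕ) (u : ℝ) (t : Fin (m + 1) → ℝ) :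
    stick (m + 1) u t = 1 / u * fKernel m u (fun i => t i.castSucc) := by
  rw [stick, Fin.prod_univ_succ, fKernel]
  congr 1
  · simp
  · refine Finset.prod_congr rfl fun i _ => ?_
    have hlast : ¬ Fin.last m < i.succ := (Fin.le_last _).not_gt
    have hIic : Finset.univ.filter (fun a => a ≤ i) = Finset.Iic i := by ext; simp
    rw [Fin.sum_univ_castSucc, one_div, if_neg hlast]
    simp [Fin.castSucc_lt_succ_iff, ← Finset.sum_filter, hIic]

theorem measurable_stick (m : ℕ) : Measurable fun q : ℝ × (Fin m → ℝ) => stick m q.1 q.2 := by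
  unfold stick
  refine Finset.measurable_prod _ fun i _ => Measurable.inv (Measurable.sub measurable_fst ?_)
  refine Finset.measurable_sum _ fun l _ => ?_
  split_ifs <;> fun_prop

theorem measurable_stick_right (m : ℕ) (u : ℝ) : Measurable (stick m u) :=
  (measurable_stick m).comp measurable_prodMk_left

/-- The points of the cube at which the partial sums cross `u - 1` at the last step and stay
below `u - v`. -/
def stopRegion (k : ℕ) (u v : ℝ) : Set (Fin (k + 1) → ℝ) :=
  {t | (∀ i, t i ∈ Set.Ioo (0 : ℝ) 1) ∧ ∑ i : Fin k, t i.castSucc ≤ u - 1 ∧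
    u - 1 < ∑ i, t i ∧ ∑ i, t i < u - v}

theorem VRegion_subset_stopRegion (k : ℕ) (u v : ℝ) : VRegion k u v ⊆ stopRegion k u v :=
  fun _ h => ⟨h.1, h.2.1.le, h.2.2⟩

theorem isOpen_VRegion (k : ℕ) (u v : ℝ) : IsOpen (VRegion k u v) := by
  have : VRegion k u v = (⋂ i, {t | t i ∈ Set.Ioo (0 : ℝ) 1}) ∩
      {t | ∑ i : Fin k, t i.castSucc < u - 1} ∩ {t | u - 1 < ∑ i, t i} ∩
      {t | ∑ i, t i < u - v} := by
    ext t; simp [VRegion, and_assoc]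
  rw [this]
  refine (((isOpen_iInter_of_finite fun i => isOpen_Ioo.preimage (continuous_apply i)).inter
    ?_).inter ?_).inter ?_
  · exact isOpen_lt (by fun_prop) continuous_const
  · exact isOpen_lt continuous_const (by fun_prop)
  · exact isOpen_lt (by fun_prop) continuous_const

theorem measurableSet_stopRegion (k : ℕ) (u v : ℝ) : MeasurableSet (stopRegion k u v) := by
  have : stopRegion k u v = (⋂ i, {t | t i ∈ Set.Ioo (0 : ℝ) 1}) ∩
      {t | ∑ i : Fin k, t i.castSucc ≤ u - 1} ∩ {t | u - 1 < ∑ i, t i} ∩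
      {t | ∑ i, t i < u - v} := by
    ext t; simp [stopRegion, and_assoc]
  rw [this]
  refine (((MeasurableSet.iInter fun i => measurableSet_Ioo.preimage (measurable_pi_apply i)).inter
    ?_).inter ?_).inter ?_
  · exact measurableSet_le (by fun_prop) measurable_const
  · exact measurableSet_lt measurable_const (by fun_prop)
  · exact measurableSet_lt (by fun_prop) measurable_const

theorem partialSum_le {k : ℕ} {t : Fin (k + 1) → ℝ} (ht : ∀ i, 0 ≤ t i) (i : Fin (k + 1)) :
    ∑ l, (if l < i then t l else 0) ≤ ∑ i : Fin k, t i.castSucc := by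
  rw [Fin.sum_univ_castSucc, if_neg (not_lt.2 (Fin.le_last i)), add_zero]
  refine Finset.sum_le_sum fun l _ => ?_
  split_ifs
  exacts [le_rfl, ht _]

/-- Before the last step a length at least `1` remains. No denominator of `stick` is therefore below
`1`, whence `0 < stick ≤ 1` on the stopping region. -/
theorem one_le_sub_partialSum {k : ℕ} {u : ℝ} {t : Fin (k + 1) → ℝ} (ht : ∀ i, 0 ≤ t i)
    (h : ∑ i : Fin k, t i.castSucc ≤ u - 1) (i : Fin (k + 1)) :
    1 ≤ u - ∑ l, (if l < i then t l else 0) := by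
  linarith [partialSum_le ht i]

theorem stick_pos {k : ℕ} {u : ℝ} {t : Fin (k + 1) → ℝ} (ht : ∀ i, 0 ≤ t i)
    (h : ∑ i : Fin k, t i.castSucc ≤ u - 1) : 0 < stick (k + 1) u t :=
  Finset.prod_pos fun i _ => inv_pos.2 (one_pos.trans_le (one_le_sub_partialSum ht h i))

theorem stick_le_one {k : ℕ} {u : ℝ} {t : Fin (k + 1) → ℝ} (ht : ∀ i, 0 ≤ t i)
    (h : ∑ i : Fin k, t i.castSucc ≤ u - 1) : stick (k + 1) u t ≤ 1 :=
  Finset.prod_le_one (fun i _ => inv_nonneg.2 (zero_le_one.trans (one_le_sub_partialSum ht h i)))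
    fun i _ => inv_le_one_of_one_le₀ (one_le_sub_partialSum ht h i)

theorem stick_mem_of_mem_stopRegion {k : ℕ} {u v : ℝ} {t : Fin (k + 1) → ℝ}
    (ht : t ∈ stopRegion k u v) : 0 < stick (k + 1) u t ∧ stick (k + 1) u t ≤ 1 :=
  ⟨stick_pos (fun i => (ht.1 i).1.le) ht.2.1, stick_le_one (fun i => (ht.1 i).1.le) ht.2.1⟩

/-- The open unit cube. -/
def cube (n : ℕ) : Set (Fin n → ℝ) := Set.univ.pi fun _ => Set.Ioo (0 : ℝ) 1

theorem volume_cube (n : ℕ) : volume (cube n) = 1 := by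
  simp [cube, Real.volume_pi_Ioo]

theorem stopRegion_subset_cube (k : ℕ) (u v : ℝ) : stopRegion k u v ⊆ cube (k + 1) :=
  fun _ h i _ => h.1 i

theorem volume_stopRegion_le (k : ℕ) (u v : ℝ) : volume (stopRegion k u v) ≤ 1 :=
  (measure_mono (stopRegion_subset_cube k u v)).trans_eq (volume_cube _)

theorem integrableOn_stick {k : ℕ} {u v : ℝ} :
    IntegrableOn (stick (k + 1) u) (stopRegion k u v) := by
  refine Measure.integrableOn_of_bounded (M := 1)
    ((volume_stopRegion_le k u v).trans_lt ENNReal.one_lt_top).ne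
    (measurable_stick_right _ _).aestronglyMeasurable ?_
  filter_upwards [ae_restrict_mem (measurableSet_stopRegion k u v)] with t ht
  have := stick_mem_of_mem_stopRegion ht
  rw [Real.norm_of_nonneg this.1.le]
  exact this.2

/-! ### The coefficients `μ_k` as integrals, and their recursion -/

theorem muK_one_eq {u v : ℝ} (S : Set (Fin 1 → ℝ))
    (hS : ∀ t, t ∈ S ↔ t 0 ∈ Set.Ioo (0 : ℝ) 1 ∩ Set.Ioo (u - 1) (u - v)) :
    muK 1 u v = ∫ t in S, stick 1 u t := by
  have h1 : ∀ t, stick 1 u t = 1 / u := by intro t; simp [stick]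
  simp only [h1]
  rw [setIntegral_const, muK, smul_eq_mul, mul_comm]
  congr 1
  rw [Measure.real]
  congr 1
  have : S = (MeasurableEquiv.funUnique (Fin 1) ℝ) ⁻¹'
      (Set.Ioo (0 : ℝ) 1 ∩ Set.Ioo (u - 1) (u - v)) := by
    ext t; rw [hS]; rfl
  rw [this]
  exact ((volume_preserving_funUnique (Fin 1) ℝ).measure_preimage_equiv _).symm

/-- At `u = 1`, `k = 0`, the strict inequality `0 < u - 1` would empty `VRegion`, while `μ_1(1, v)`
need not vanish; hence `1 < u`. -/
theorem muK_eq_integral {k : ℕ} {u v : ℝ} (hu : 1 < u) :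
    muK (k + 1) u v = ∫ t in VRegion k u v, stick (k + 1) u t := by
  cases k with
  | zero => exact muK_one_eq _ fun t => by simp [VRegion, hu]
  | succ k => simp only [muK, stick_eq_fKernel, integral_const_mul]

/-- The non-strict inequality in `stopRegion` is what admits `u = 1`; an upper bound suffices for
the comparison with cells. -/
theorem muK_le_integral {k : ℕ} {u v : ℝ} (hu : 1 ≤ u) :
    muK (k + 1) u v ≤ ∫ t in stopRegion k u v, stick (k + 1) u t := by
  cases k with
  | zero => exact (muK_one_eq _ fun t => by simp [stopRegion, hu]).le
  | succ k =>
    have : muK (k + 2) u v = ∫ t in VRegion (k + 1) u v, stick (k + 2) u t := by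
      simp only [muK, stick_eq_fKernel, integral_const_mul]
    rw [this]
    refine setIntegral_mono_set integrableOn_stick ?_
      (VRegion_subset_stopRegion _ _ _).eventuallyLE
    filter_upwards [ae_restrict_mem (measurableSet_stopRegion (k + 1) u v)] with t ht
    exact (stick_mem_of_mem_stopRegion ht).1.le

theorem muK_nonneg {k : ℕ} {u v : ℝ} (hu : 1 ≤ u) : 0 ≤ muK (k + 1) u v := by
  cases k with
  | zero =>
    rw [muK]
    positivity
  | succ k =>
    have : muK (k + 2) u v = ∫ t in VRegion (k + 1) u v, stick (k + 2) u t := by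
      simp only [muK, stick_eq_fKernel, integral_const_mul]
    rw [this]
    exact setIntegral_nonneg (isOpen_VRegion _ _ _).measurableSet fun t ht =>
      (stick_mem_of_mem_stopRegion (VRegion_subset_stopRegion _ _ _ ht)).1.le

theorem muK_le_one {k : ℕ} {u v : ℝ} (hu : 1 ≤ u) : muK (k + 1) u v ≤ 1 := by
  refine (muK_le_integral hu).trans ?_
  calc ∫ t in stopRegion k u v, stick (k + 1) u t ≤ ∫ t in stopRegion k u v, (1 : ℝ) :=
        setIntegral_mono_on integrableOn_stick
          (integrableOn_const ((volume_stopRegion_le k u v).trans_lt ENNReal.one_lt_top).ne)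
          (measurableSet_stopRegion k u v) fun t ht => (stick_mem_of_mem_stopRegion ht).2
    _ ≤ 1 := by
        rw [setIntegral_const, smul_eq_mul, mul_one, Measure.real]
        exact ENNReal.toReal_mono ENNReal.one_ne_top (volume_stopRegion_le k u v)

theorem cons_mem_VRegion {k : ℕ} {u v t : ℝ} {s : Fin (k + 1) → ℝ} :
    (Fin.cons t s : Fin (k + 2) → ℝ) ∈ VRegion (k + 1) u v ↔
      t ∈ Set.Ioo (0 : ℝ) 1 ∩ Set.Iio (u - 1) ∧ s ∈ VRegion k (u - t) v := by
  have h1 : ∑ i : Fin (k + 1), (Fin.cons t s : Fin (k + 2) → ℝ) i.castSucc =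
      t + ∑ i : Fin k, s i.castSucc := by
    rw [Fin.sum_univ_succ]
    simp
  have h2 : ∑ i : Fin (k + 2), (Fin.cons t s : Fin (k + 2) → ℝ) i = t + ∑ i, s i := by
    rw [Fin.sum_univ_succ]; simp
  simp only [VRegion, Set.mem_ofPred_eq, h1, h2, Fin.forall_fin_succ (n := k + 1), Fin.cons_zero,
    Fin.cons_succ, Set.mem_inter_iff, Set.mem_Iio]
  constructor
  · rintro ⟨⟨h, h'⟩, h3, h4, h5⟩
    have : 0 ≤ ∑ i : Fin k, s i.castSucc := Finset.sum_nonneg fun i _ => (h' _).1.le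
    exact ⟨⟨h, by linarith⟩, h', by linarith, by linarith, by linarith⟩
  · rintro ⟨⟨h, h0⟩, h', h3, h4, h5⟩
    exact ⟨⟨h, h'⟩, by linarith, by linarith, by linarith⟩

/-- Fubini in the first coordinate: after a first piece `t < u - 1`, the remaining pieces form a
point of `VRegion k (u - t) v`. -/
theorem muK_recursion (k : ℕ) (u v : ℝ) :
    IntegrableOn (fun t => muK (k + 1) (u - t) v) (Set.Ioo (0 : ℝ) 1 ∩ Set.Iio (u - 1)) ∧
    muK (k + 2) u v =
      1 / u * ∫ t in Set.Ioo (0 : ℝ) 1 ∩ Set.Iio (u - 1), muK (k + 1) (u - t) v := by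
  set J := Set.Ioo (0 : ℝ) 1 ∩ Set.Iio (u - 1)
  have hJm : MeasurableSet J := measurableSet_Ioo.inter measurableSet_Iio
  set e := MeasurableEquiv.piFinSuccAbove (fun _ : Fin (k + 2) => ℝ) 0
  have he : MeasurePreserving e.symm (volume.prod volume) volume :=
    (volume_preserving_piFinSuccAbove (fun _ : Fin (k + 2) => ℝ) 0).symm e
  have hes : ∀ q, e.symm q = Fin.cons q.1 q.2 := fun q => by
    simp [e, MeasurableEquiv.piFinSuccAbove]
    rfl
  let D : Set (ℝ × (Fin (k + 1) → ℝ)) := {q | Fin.cons q.1 q.2 ∈ VRegion (k + 1) u v}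
  have hD : ∀ t s, (t, s) ∈ D ↔ t ∈ J ∧ s ∈ VRegion k (u - t) v := fun t s => cons_mem_VRegion
  let g : ℝ × (Fin (k + 1) → ℝ) → ℝ := D.indicator fun q => stick (k + 1) (u - q.1) q.2
  have hcomp : ∀ q, (VRegion (k + 1) u v).indicator (stick (k + 2) u) (e.symm q) =
      u⁻¹ * g q := by
    intro q
    rw [hes]
    by_cases h : q ∈ D
    · rw [Set.indicator_of_mem (show Fin.cons q.1 q.2 ∈ VRegion (k + 1) u v from h),
        show g q = _ from Set.indicator_of_mem h _, stick_cons]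
    · rw [Set.indicator_of_notMem (show Fin.cons q.1 q.2 ∉ VRegion (k + 1) u v from h),
        show g q = _ from Set.indicator_of_notMem h _, mul_zero]
  have hS : MeasurableSet D := by
    have := (isOpen_VRegion (k + 1) u v).measurableSet.preimage e.symm.measurable
    convert this using 1
    ext q
    exact iff_of_eq (congrArg (· ∈ VRegion (k + 1) u v) (hes q).symm)
  have hgi : Integrable g (volume.prod volume) := by
    rw [integrable_indicator_iff hS]
    refine Measure.integrableOn_of_bounded (M := 1) ?_ ?_ ?_
    · refine ((measure_mono (t := J ×ˢ cube (k + 1)) ?_).trans_lt ?_).ne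
      · rintro ⟨t, s⟩ h
        have := cons_mem_VRegion.1 h
        exact ⟨this.1, fun i _ => this.2.1 i⟩
      · rw [Measure.prod_prod, volume_cube, mul_one]
        exact (measure_mono Set.inter_subset_left).trans_lt (by simp)
    · exact ((measurable_stick (k + 1)).comp
        ((measurable_const.sub measurable_fst).prodMk measurable_snd)).aestronglyMeasurable
    · filter_upwards [ae_restrict_mem hS] with q hq
      have := stick_mem_of_mem_stopRegion
        (VRegion_subset_stopRegion _ _ _ (cons_mem_VRegion.1 hq).2)
      rw [Real.norm_of_nonneg this.1.le]
      exact this.2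
  have hslice : ∀ t, ∫ s, g (t, s) = J.indicator (fun t => muK (k + 1) (u - t) v) t := by
    intro t
    by_cases ht : t ∈ J
    · rw [Set.indicator_of_mem ht, muK_eq_integral (by have := ht.2; simp at this; linarith),
        ← integral_indicator (isOpen_VRegion _ _ _).measurableSet]
      congr 1
      ext s
      by_cases hs : s ∈ VRegion k (u - t) v
      · rw [Set.indicator_of_mem hs]
        exact Set.indicator_of_mem ((hD t s).2 ⟨ht, hs⟩) _
      · rw [Set.indicator_of_notMem hs]
        exact Set.indicator_of_notMem (fun h => hs ((hD t s).1 h).2) _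
    · rw [Set.indicator_of_notMem ht]
      exact integral_eq_zero_of_ae (Eventually.of_forall fun s =>
        Set.indicator_of_notMem (fun h => ht ((hD t s).1 h).1) _)
  refine ⟨?_, ?_⟩
  · have := hgi.integral_prod_left
    simp only [hslice] at this
    exact (integrable_indicator_iff hJm).1 this
  · have h0 : muK (k + 2) u v = ∫ t in VRegion (k + 1) u v, stick (k + 2) u t := by
      simp only [muK, stick_eq_fKernel, integral_const_mul]
    rw [h0, ← integral_indicator (isOpen_VRegion _ _ _).measurableSet,
      ← he.integral_comp' (f := e.symm)]
    simp only [hcomp]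
    rw [integral_const_mul, integral_prod _ hgi]
    simp only [hslice]
    rw [integral_indicator hJm, one_div]

/-! ### Stick-breaking on the prime factors of one integer -/

/-- The exponents `log pᵢ / log y`. -/
noncomputable def logRatio (y : ℝ) {m : ℕ} (p : Fin m → ℕ) (i : Fin m) : ℝ :=
  Real.log (p i) / Real.log y

/-- The stick-breaking weight of a tuple of primes. -/
noncomputable def weight (y u : ℝ) {m : ℕ} (p : Fin m → ℕ) : ℝ :=
  (∏ i, logRatio y p i) * stick m u (logRatio y p)

/-- The tuples of primes with product dividing `n` and exponent sum at most `u - 1`. -/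
noncomputable def liveTuples (n : ℕ) (y u : ℝ) (m : ℕ) : Finset (Fin m → ℕ) :=
  (Fintype.piFinset fun _ => n.primeFactors).filter fun p =>
    ∏ i, p i ∣ n ∧ ∑ i, logRatio y p i ≤ u - 1

/-- The tuples of primes with product dividing `n` whose exponent sum exceeds `u - 1` for the
first time at the last step. -/
noncomputable def stopTuples (n : ℕ) (y u : ℝ) (m : ℕ) : Finset (Fin (m + 1) → ℕ) :=
  (Fintype.piFinset fun _ => n.primeFactors).filter fun p =>
    ∏ i, p i ∣ n ∧ ∑ i : Fin m, logRatio y p i.castSucc ≤ u - 1 ∧ u - 1 < ∑ i, logRatio y p i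

theorem logRatio_nonneg {y : ℝ} (hy : 1 < y) {m : ℕ} (p : Fin m → ℕ) (i : Fin m) :
    0 ≤ logRatio y p i :=
  div_nonneg (Real.log_natCast_nonneg _) (Real.log_pos hy).le

theorem stick_nonneg_of_sum_le {m : ℕ} {u : ℝ} {t : Fin m → ℝ} (ht : ∀ i, 0 ≤ t i)
    (h : ∑ i, t i ≤ u - 1) : 0 ≤ stick m u t := by
  cases m with
  | zero => simp [stick]
  | succ k =>
    rw [Fin.sum_univ_castSucc] at h
    exact (stick_pos ht (by linarith [ht (Fin.last k)])).le

theorem weight_castSucc (y u : ℝ) {m : ℕ} (p : Fin (m + 1) → ℕ) :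
    weight y u p = weight y u (fun i => p i.castSucc) *
      (logRatio y p (Fin.last m) / (u - ∑ i : Fin m, logRatio y p i.castSucc)) := by
  have h : logRatio y (fun i => p (Fin.castSucc i)) = fun i => logRatio y p i.castSucc := rfl
  rw [weight, stick_castSucc, Fin.prod_univ_castSucc, weight, h]
  ring

theorem sum_log_primeFactors_le {k : ℕ} (hk : k ≠ 0) :
    ∑ q ∈ k.primeFactors, Real.log q ≤ Real.log k := by
  rw [← Real.log_prod fun q hq => by exact_mod_cast (Nat.prime_of_mem_primeFactors hq).ne_zero,
    ← Nat.cast_prod]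
  have h0 : 0 < ∏ q ∈ k.primeFactors, q := Nat.pos_of_dvd_of_pos (Nat.prod_primeFactors_dvd k)
    (Nat.pos_of_ne_zero hk)
  refine Real.log_le_log (by exact_mod_cast h0) ?_
  exact_mod_cast Nat.le_of_dvd (Nat.pos_of_ne_zero hk) (Nat.prod_primeFactors_dvd k)

theorem log_div_prod {n m : ℕ} (hn : n ≠ 0) {y u : ℝ} (hy : 1 < y)
    (hnu : Real.log n ≤ u * Real.log y) {p : Fin m → ℕ} (hp : ∏ i, p i ∣ n) :
    Real.log (n / ∏ i, p i : ℕ) ≤ (u - ∑ i, logRatio y p i) * Real.log y := by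
  have hly := Real.log_pos hy
  have h0 : ∏ i, p i ≠ 0 := fun h => hn (by rw [h] at hp; exact zero_dvd_iff.1 hp)
  have hi : ∀ i, p i ≠ 0 := fun i h => h0 (Finset.prod_eq_zero (Finset.mem_univ i) h)
  rw [Nat.cast_div hp (by exact_mod_cast h0), Real.log_div (by exact_mod_cast hn)
    (by exact_mod_cast h0), Nat.cast_prod, Real.log_prod fun i _ => by exact_mod_cast hi i, sub_mul,
    Finset.sum_mul]
  have : ∑ i, logRatio y p i * Real.log y = ∑ i, Real.log (p i) :=
    Finset.sum_congr rfl fun i _ => div_mul_cancel₀ _ hly.ne'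
  linarith

/-- Mass does not increase: each tuple of length `m + 1` extends a live tuple `p` by a prime `q`
dividing the cofactor, at a factor `log q / ((u - ∑ tᵢ) log y)`. Over `q` these factors sum to at
most `1`. -/
theorem sum_weight_live_add_stop_le {n : ℕ} (hn : n ≠ 0) {y u : ℝ} (hy : 1 < y)
    (hnu : Real.log n ≤ u * Real.log y) (m : ℕ) :
    ∑ p ∈ liveTuples n y u (m + 1), weight y u p + ∑ p ∈ stopTuples n y u m, weight y u p ≤
      ∑ p ∈ liveTuples n y u m, weight y u p := by
  classical
  have hly := Real.log_pos hy
  set E : Finset (Fin (m + 1) → ℕ) := (Fintype.piFinset fun _ => n.primeFactors).filter fun p =>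
    ∏ i, p i ∣ n ∧ ∑ i : Fin m, logRatio y p i.castSucc ≤ u - 1 with hE
  have h1 : liveTuples n y u (m + 1) = E.filter fun p => ∑ i, logRatio y p i ≤ u - 1 := by
    ext p
    simp only [liveTuples, hE, Finset.mem_filter]
    constructor
    · rintro ⟨h, h', h''⟩
      refine ⟨⟨h, h', ?_⟩, h''⟩
      rw [Fin.sum_univ_castSucc] at h''
      linarith [logRatio_nonneg hy p (Fin.last m)]
    · rintro ⟨⟨h, h', _⟩, h''⟩
      exact ⟨h, h', h''⟩
  have h2 : stopTuples n y u m = E.filter fun p => ¬ ∑ i, logRatio y p i ≤ u - 1 := by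
    ext p
    simp only [stopTuples, hE, Finset.mem_filter, not_le, and_assoc]
  rw [h1, h2, Finset.sum_filter_add_sum_filter_not]
  -- The tuples of `E`, whether they survive or stop, are reindexed by their first `m` entries and
  -- their last prime.
  have h3 : ∑ p ∈ E, weight y u p = ∑ q ∈ (liveTuples n y u m).sigma
      (fun p => (n / ∏ i, p i).primeFactors), weight y u (Fin.snoc q.1 q.2 : Fin (m + 1) → ℕ) := by
    refine Finset.sum_bij' (fun p _ => ⟨fun i => p i.castSucc, p (Fin.last m)⟩)
      (fun q _ => Fin.snoc q.1 q.2) ?_ ?_ ?_ ?_ ?_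
    · intro p hp
      simp only [hE, Finset.mem_filter, Fintype.mem_piFinset, Fin.prod_univ_castSucc] at hp
      obtain ⟨hp, hd, hs⟩ := hp
      simp only [Finset.mem_sigma, liveTuples, Finset.mem_filter, Fintype.mem_piFinset]
      have hd' := dvd_of_mul_right_dvd hd
      refine ⟨⟨fun i => hp _, hd', hs⟩, ?_⟩
      refine Nat.mem_primeFactors.2 ⟨Nat.prime_of_mem_primeFactors (hp _),
        (Nat.dvd_div_iff_mul_dvd hd').2 hd, ?_⟩
      exact (Nat.div_pos (Nat.le_of_dvd (Nat.pos_of_ne_zero hn) hd')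
        (Nat.pos_of_dvd_of_pos hd' (Nat.pos_of_ne_zero hn))).ne'
    · rintro ⟨p, q⟩ hq
      simp only [Finset.mem_sigma, liveTuples, Finset.mem_filter, Fintype.mem_piFinset] at hq
      obtain ⟨⟨hp, hd, hs⟩, hq⟩ := hq
      have hqd := (Nat.dvd_div_iff_mul_dvd hd).1 (Nat.dvd_of_mem_primeFactors hq)
      simp only [hE, Finset.mem_filter, Fintype.mem_piFinset, Fin.prod_univ_castSucc,
        Fin.snoc_castSucc, Fin.snoc_last, logRatio]
      refine ⟨fun i => ?_, hqd, hs⟩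
      refine Fin.lastCases ?_ (fun i => ?_) i
      · rw [Fin.snoc_last]
        exact Nat.mem_primeFactors.2 ⟨Nat.prime_of_mem_primeFactors hq,
          (dvd_mul_left _ _).trans hqd, hn⟩
      · rw [Fin.snoc_castSucc]
        exact hp i
    · intro p _
      exact Fin.snoc_init_self p
    · rintro ⟨p, q⟩ _
      simp
    · intro p _
      congr 1
      exact (Fin.snoc_init_self p).symm
  rw [h3, Finset.sum_sigma]
  refine Finset.sum_le_sum fun p hp => ?_
  simp only [liveTuples, Finset.mem_filter] at hp
  obtain ⟨-, hd, hs⟩ := hp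
  have hk : n / ∏ i, p i ≠ 0 := (Nat.div_pos (Nat.le_of_dvd (Nat.pos_of_ne_zero hn) hd)
        (Nat.pos_of_dvd_of_pos hd (Nat.pos_of_ne_zero hn))).ne'
  have hw : 0 ≤ weight y u p := mul_nonneg (Finset.prod_nonneg fun i _ => logRatio_nonneg hy p i)
    (stick_nonneg_of_sum_le (logRatio_nonneg hy p) hs)
  have hden : 0 < u - ∑ i, logRatio y p i := by linarith
  have h4 : ∀ q : ℕ, weight y u (Fin.snoc p q : Fin (m + 1) → ℕ) =
      weight y u p * ((u - ∑ i, logRatio y p i) * Real.log y)⁻¹ * Real.log q := by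
    intro q
    rw [weight_castSucc]
    simp only [Fin.snoc_castSucc, Fin.snoc_last, logRatio]
    field_simp
  simp only [h4]
  rw [← Finset.mul_sum, mul_assoc]
  refine mul_le_of_le_one_right hw ?_
  rw [inv_mul_le_iff₀ (by positivity), mul_one]
  exact (sum_log_primeFactors_le hk).trans (log_div_prod hn hy hnu hd)

/-- Telescoping of the preceding inequality: the process starts with mass at most `1`, carried by
the empty tuple, and the surviving mass is nonnegative. -/
theorem sum_weight_stop_le {n : ℕ} (hn : n ≠ 0) {y u : ℝ} (hy : 1 < y)
    (hnu : Real.log n ≤ u * Real.log y) (K : ℕ) :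
    ∑ m ∈ Finset.range K, ∑ p ∈ stopTuples n y u m, weight y u p ≤ 1 := by
  have key : ∑ p ∈ liveTuples n y u K, weight y u p +
      ∑ m ∈ Finset.range K, ∑ p ∈ stopTuples n y u m, weight y u p ≤ 1 := by
    induction K with
    | zero =>
      have h : ∀ p ∈ liveTuples n y u 0, weight y u p = 1 := fun p _ => by simp [weight, stick]
      rw [Finset.sum_congr rfl h]
      have : (liveTuples n y u 0).card ≤ 1 := (Finset.card_le_univ _).trans (by simp)
      simpa using this
    | succ K ih =>
      rw [Finset.sum_range_succ]
      linarith [sum_weight_live_add_stop_le hn hy hnu K]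
  refine le_trans ?_ key
  refine le_add_of_nonneg_left (Finset.sum_nonneg fun p hp => ?_)
  simp only [liveTuples, Finset.mem_filter] at hp
  exact mul_nonneg (Finset.prod_nonneg fun i _ => logRatio_nonneg hy p i)
    (stick_nonneg_of_sum_le (logRatio_nonneg hy p) hp.2.2)

/-- An integer with a stopping tuple of primes `≤ y` is `y`-friable. -/
theorem largestPrimeFactor_le_of_stop {n m : ℕ} (hn : n ≠ 0) {y u : ℝ} (hy : 1 < y)
    (hnu : Real.log n ≤ u * Real.log y) {p : Fin (m + 1) → ℕ} (hp : p ∈ stopTuples n y u m)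
    (hpy : ∀ i, (p i : ℝ) ≤ y) : (largestPrimeFactor n : ℝ) ≤ y := by
  have hly := Real.log_pos hy
  simp only [stopTuples, Finset.mem_filter, Fintype.mem_piFinset] at hp
  obtain ⟨hpr, hd, -, hs⟩ := hp
  have hk : n / ∏ i, p i ≠ 0 := (Nat.div_pos (Nat.le_of_dvd (Nat.pos_of_ne_zero hn) hd)
        (Nat.pos_of_dvd_of_pos hd (Nat.pos_of_ne_zero hn))).ne'
  -- The exponent sum exceeds `u - 1`, so less than `1` is left for the cofactor. A prime factor of
  -- `n` either is some `p i` or divides this cofactor.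
  have hlt : ((n / ∏ i, p i : ℕ) : ℝ) ≤ y := by
    refine (Real.log_le_log_iff (by exact_mod_cast Nat.pos_of_ne_zero hk) (by linarith)).1 ?_
    refine (log_div_prod hn hy hnu hd).trans ?_
    nlinarith
  have hall : ∀ q ∈ n.primeFactors, (q : ℝ) ≤ y := by
    intro q hq
    have hqp := Nat.prime_of_mem_primeFactors hq
    have hqn := Nat.dvd_of_mem_primeFactors hq
    rw [← Nat.mul_div_cancel' hd] at hqn
    rcases hqp.dvd_mul.1 hqn with h | h
    · obtain ⟨i, -, hi⟩ := (hqp.prime.dvd_finsetProd_iff _).1 h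
      have := (Nat.prime_dvd_prime_iff_eq hqp (Nat.prime_of_mem_primeFactors (hpr i))).1 hi
      rw [this]
      exact hpy i
    · refine le_trans ?_ hlt
      exact_mod_cast Nat.le_of_dvd (Nat.pos_of_ne_zero hk) h
  have : largestPrimeFactor n ≤ ⌊y⌋₊ := by
    refine max_le (Nat.le_floor (by exact_mod_cast hy.le)) (Finset.sup_le fun q hq => ?_)
    exact Nat.le_floor (hall q hq)
  exact (Nat.cast_le.2 this).trans (Nat.floor_le (by linarith))

/-! ### Partial summation and the mass of primes in `(y^a, y^b]` -/

theorem hasDerivAt_inv_log {t : ℝ} (ht : 1 < t) :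
    HasDerivAt (fun s => (Real.log s)⁻¹) (-(1 / (t * Real.log t ^ 2))) t := by
  have h := (Real.hasDerivAt_log (by linarith : t ≠ 0)).inv (Real.log_pos ht).ne'
  exact h.congr_deriv (by field_simp)

/-- Partial summation: a lower bound for `∑ c(n) / log n` from a two-sided bound for the
summatory function of `c`. -/
theorem le_sum_div_log {c : ℕ → ℝ} {κ A w z : ℝ} (hw : 2 ≤ w) (hwz : w ≤ z)
    (h : ∀ t : ℝ, 2 ≤ t → |∑ n ∈ Finset.Icc 0 ⌊t⌋₊, c n - κ * Real.log t| ≤ A) :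
    κ * Real.log (Real.log z / Real.log w) - 2 * A / Real.log w ≤
      ∑ n ∈ Finset.Ioc ⌊w⌋₊ ⌊z⌋₊, c n / Real.log n := by
  have hpos : ∀ t ∈ Set.Icc w z, 0 < Real.log t := fun t ht => Real.log_pos (by linarith [ht.1])
  have hne : ∀ t ∈ Set.Icc w z, t * Real.log t ^ 2 ≠ 0 := fun t ht =>
    mul_ne_zero (by linarith [ht.1]) (pow_ne_zero _ (hpos t ht).ne')
  have hlogc : ContinuousOn Real.log (Set.Icc w z) :=
    Real.continuousOn_log.mono fun t ht => by
      have := ht.1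
      simp only [Set.mem_compl_iff, Set.mem_singleton_iff]
      linarith
  have hcont : ContinuousOn (fun t : ℝ => -(1 / (t * Real.log t ^ 2))) (Set.Icc w z) :=
    (continuousOn_const.div (continuousOn_id.mul (hlogc.pow 2)) hne).neg
  have hder : ∀ t ∈ Set.Icc w z, deriv (fun s => (Real.log s)⁻¹) t =
      -(1 / (t * Real.log t ^ 2)) := fun t ht => (hasDerivAt_inv_log (by linarith [ht.1])).deriv
  have hint : IntegrableOn (deriv fun s => (Real.log s)⁻¹) (Set.Icc w z) :=
    (hcont.congr hder).integrableOn_Icc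
  have habel := sum_mul_eq_sub_sub_integral_mul c (f := fun s => (Real.log s)⁻¹)
    (by linarith : 0 ≤ w) hwz
    (fun t ht => (hasDerivAt_inv_log (by linarith [ht.1])).differentiableAt) hint
  have hlhs : ∑ n ∈ Finset.Ioc ⌊w⌋₊ ⌊z⌋₊, c n / Real.log n =
      ∑ k ∈ Finset.Ioc ⌊w⌋₊ ⌊z⌋₊, (fun s : ℝ => (Real.log s)⁻¹) k * c k :=
    Finset.sum_congr rfl fun n _ => by rw [div_eq_inv_mul]
  -- the primitive of the minorant
  have hprim : ∀ t ∈ Set.uIcc w z, HasDerivAt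
      (fun s => -(κ * Real.log (Real.log s)) - A * (Real.log s)⁻¹)
      (-(1 / (t * Real.log t ^ 2)) * (κ * Real.log t - A)) t := by
    intro t ht
    rw [Set.uIcc_of_le hwz] at ht
    have hl := hpos t ht
    have ht0 : t ≠ 0 := by linarith [ht.1]
    have h1 := ((((Real.hasDerivAt_log ht0).log hl.ne').const_mul κ).neg).sub
      ((hasDerivAt_inv_log (by linarith [ht.1] : 1 < t)).const_mul A)
    exact h1.congr_deriv (by field_simp; ring)
  have hmin : ContinuousOn (fun t : ℝ => -(1 / (t * Real.log t ^ 2)) * (κ * Real.log t - A))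
      (Set.Icc w z) := hcont.mul ((continuousOn_const.mul hlogc).sub continuousOn_const)
  have hI := intervalIntegral.integral_eq_sub_of_hasDerivAt hprim
    (by rw [← Set.uIcc_of_le hwz] at hmin; exact hmin.intervalIntegrable)
  rw [intervalIntegral.integral_of_le hwz] at hI
  have hS : IntegrableOn (fun t => deriv (fun s => (Real.log s)⁻¹) t *
      ∑ k ∈ Finset.Icc 0 ⌊t⌋₊, c k) (Set.Ioc w z) :=
    (integrableOn_mul_sum_Icc c (m := 0) (by linarith) hint).mono_set Set.Ioc_subset_Icc_self
  -- The derivative of `1 / log` is negative, so the lower bound `κ log t - A` for the summatory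
  -- function bounds this integral from above.
  have hle : ∫ t in Set.Ioc w z, deriv (fun s => (Real.log s)⁻¹) t *
      ∑ k ∈ Finset.Icc 0 ⌊t⌋₊, c k ≤
      ∫ t in Set.Ioc w z, -(1 / (t * Real.log t ^ 2)) * (κ * Real.log t - A) := by
    refine setIntegral_mono_on hS (hmin.integrableOn_Icc.mono_set Set.Ioc_subset_Icc_self)
      measurableSet_Ioc fun t ht => ?_
    have ht' := Set.Ioc_subset_Icc_self ht
    rw [hder t ht']
    refine mul_le_mul_of_nonpos_left ?_ ?_
    · linarith [(abs_le.1 (h t (by linarith [ht.1]))).1]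
    · have : 0 < t := by linarith [ht.1]
      have := hpos t ht'
      simp only [Left.neg_nonpos_iff]
      positivity
  rw [hI] at hle
  rw [hlhs, habel]
  have lw := hpos w ⟨le_rfl, hwz⟩
  have lz := hpos z ⟨hwz, le_rfl⟩
  have hz := (abs_le.1 (h z (by linarith))).1
  have hw' := (abs_le.1 (h w hw)).2
  have e1 : κ - A * (Real.log z)⁻¹ ≤ (Real.log z)⁻¹ * ∑ k ∈ Finset.Icc 0 ⌊z⌋₊, c k := by
    have := mul_le_mul_of_nonneg_left (by linarith : κ * Real.log z - A ≤ ∑ k ∈ Finset.Icc 0 ⌊z⌋₊, c k) (inv_pos.2 lz).le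
    refine le_trans (le_of_eq ?_) this
    field_simp
  have e2 : (Real.log w)⁻¹ * ∑ k ∈ Finset.Icc 0 ⌊w⌋₊, c k ≤ κ + A * (Real.log w)⁻¹ := by
    have := mul_le_mul_of_nonneg_left (by linarith : ∑ k ∈ Finset.Icc 0 ⌊w⌋₊, c k ≤ κ * Real.log w + A) (inv_pos.2 lw).le
    refine this.trans (le_of_eq ?_)
    field_simp
  rw [Real.log_div lz.ne' lw.ne', div_eq_mul_inv]
  linarith

/-- The sum of `γ(p)/p` over the primes `p ∈ (w, z]`. -/
noncomputable def primeMass (γ : ArithmeticFunction ℝ) (w z : ℝ) : ℝ :=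
  ∑ p ∈ (Finset.Ioc ⌊w⌋₊ ⌊z⌋₊).filter Nat.Prime, γ p / p

theorem le_primeMass {γ : ArithmeticFunction ℝ} {κ A w z : ℝ} (h : CondA γ κ A) (hw : 2 ≤ w)
    (hwz : w ≤ z) :
    κ * Real.log (Real.log z / Real.log w) - 2 * A / Real.log w ≤ primeMass γ w z := by
  have := le_sum_div_log (c := fun p => if p.Prime then Real.log p / p * γ p else 0) (κ := κ)
    (A := A) hw hwz fun t ht => by
      convert h t ht using 3
      rw [← Finset.sum_filter]
      refine Finset.sum_congr ?_ fun _ _ => rfl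
      ext p
      simp only [Finset.mem_filter, Finset.mem_Icc]
      exact ⟨fun h => ⟨⟨h.2.one_le, h.1.2⟩, h.2⟩, fun h => ⟨⟨zero_le, h.1.2⟩, h.2⟩⟩
  refine this.trans_eq ?_
  rw [primeMass, Finset.sum_filter]
  refine Finset.sum_congr rfl fun p _ => ?_
  split_ifs with hp
  · have : 0 < Real.log p := Real.log_pos (by exact_mod_cast hp.one_lt)
    field_simp
  · simp

/-- For fixed `0 < a < b`, the mass of the primes of `(y^a, y^b]` is eventually at least
`κ (b - a) / b`. -/
theorem eventually_le_primeMass {κ a b : ℝ} (hκ : 0 < κ) (A : ℝ) (ha : 0 < a) (hab : a < b) :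
    ∀ᶠ y : ℝ in atTop, ∀ γ : ArithmeticFunction ℝ, CondA γ κ A →
      κ * ((b - a) / b) ≤ primeMass γ (y ^ a) (y ^ b) := by
  have hb := ha.trans hab
  -- Strictness of `log s < s - 1` at `s = a / b` leaves a fixed margin, which absorbs the error `2A
  -- / (a log y)` for large `y`.
  have hlog : (b - a) / b < Real.log (b / a) := by
    have := Real.log_lt_sub_one_of_pos (div_pos ha hb) ((div_lt_one hb).2 hab).ne
    rw [Real.log_div hb.ne' ha.ne']
    rw [Real.log_div ha.ne' hb.ne'] at this
    rw [sub_div, div_self hb.ne']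
    linarith
  have ht : Tendsto (fun y : ℝ => 2 * A / (a * Real.log y)) atTop (𝓝 0) :=
    tendsto_const_nhds.div_atTop (Real.tendsto_log_atTop.const_mul_atTop ha)
  filter_upwards [ht.eventually_lt_const (mul_pos hκ (sub_pos.2 hlog)),
    (tendsto_rpow_atTop ha).eventually_ge_atTop 2, eventually_gt_atTop 1] with y h1 h2 h3 γ hγ
  have hl := Real.log_pos h3
  have := le_primeMass hγ h2 (Real.rpow_le_rpow_of_exponent_le h3.le hab.le)
  rw [Real.log_rpow (by linarith), Real.log_rpow (by linarith), mul_div_mul_right _ _ hl.ne'] at this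
  linarith

/-! ### Decomposition of the stopping region into cells -/

/-- Fubini: the coordinates other than `i` range over a unit cube, of volume `1`. -/
theorem volume_le_of_slices {n : ℕ} (i : Fin (n + 1)) {S : Set (Fin (n + 1) → ℝ)}
    (hS : MeasurableSet S) (hc : S ⊆ cube (n + 1)) {c : ENNReal}
    (h : ∀ s : Fin n → ℝ, volume {x : ℝ | (i.insertNth x s : Fin (n + 1) → ℝ) ∈ S} ≤ c) :
    volume S ≤ c := by
  set e := MeasurableEquiv.piFinSuccAbove (fun _ : Fin (n + 1) => ℝ) i
  have he : MeasurePreserving e.symm (volume.prod volume) volume :=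
    (volume_preserving_piFinSuccAbove (fun _ : Fin (n + 1) => ℝ) i).symm e
  have hes : ∀ x s, e.symm (x, s) = i.insertNth x s := fun x s => rfl
  rw [← he.measure_preimage hS.nullMeasurableSet,
    Measure.prod_apply_symm (hS.preimage e.symm.measurable)]
  have hcm : MeasurableSet (cube n) := MeasurableSet.univ_pi fun _ => measurableSet_Ioo
  calc ∫⁻ s, volume ((fun x => (x, s)) ⁻¹' (e.symm ⁻¹' S))
      ≤ ∫⁻ s, (cube n).indicator (fun _ => c) s := by
        refine lintegral_mono fun s => ?_
        by_cases hs : s ∈ cube n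
        · rw [Set.indicator_of_mem hs]
          exact h s
        · rw [Set.indicator_of_notMem hs, nonpos_iff_eq_zero]
          convert measure_empty (μ := (volume : Measure ℝ))
          ext x
          simp only [Set.mem_preimage, hes, Set.mem_empty_iff_false, iff_false]
          intro hx
          refine hs fun l _ => ?_
          have := hc hx (i.succAbove l) trivial
          rwa [Fin.insertNth_apply_succAbove] at this
    _ = c := by rw [lintegral_indicator_const hcm, volume_cube, mul_one]

/-- As `ℓ` has slope `1` in coordinate `i`, every slice of the slab in that direction lies in an
interval of length `c`. -/
theorem volume_slab_le {n : ℕ} (i : Fin (n + 1)) {ℓ : (Fin (n + 1) → ℝ) → ℝ} (hℓ : Measurable ℓ)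
    (h : ∀ (x : ℝ) (s : Fin n → ℝ), ℓ (i.insertNth x s) = x + ℓ (i.insertNth 0 s)) (α c : ℝ) :
    volume (cube (n + 1) ∩ {t | ℓ t ∈ Set.Icc α (α + c)}) ≤ ENNReal.ofReal c := by
  refine volume_le_of_slices i ?_ Set.inter_subset_left fun s => ?_
  · exact (MeasurableSet.univ_pi fun _ => measurableSet_Ioo).inter (hℓ measurableSet_Icc)
  · refine (measure_mono (t := Set.Icc (α - ℓ (i.insertNth 0 s))
      (α - ℓ (i.insertNth 0 s) + c)) fun x hx => ?_).trans (by simp)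
    have : ℓ (i.insertNth x s) ∈ Set.Icc α (α + c) := hx.2
    rw [h] at this
    constructor <;> linarith [this.1, this.2]

/-- The cells with indices in `[M, N)` contained in the region where the partial sums cross
`u - 1` at the last step and stay below `u - v`. -/
noncomputable def goodCells (N M k : ℕ) (u v : ℝ) : Finset (Fin (k + 1) → ℕ) :=
  open Classical in
  (Fintype.piFinset fun _ => Finset.Ico M N).filter fun j =>
    Function.Injective j ∧ ∑ i : Fin k, ((j i.castSucc : ℝ) + 1) / N ≤ u - 1 ∧
      u - 1 ≤ ∑ i, (j i : ℝ) / N ∧ ∑ i, ((j i : ℝ) + 1) / N ≤ u - v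

theorem mem_goodCells {N M k : ℕ} {u v : ℝ} {j : Fin (k + 1) → ℕ} :
    j ∈ goodCells N M k u v ↔ (∀ i, M ≤ j i ∧ j i < N) ∧
      Function.Injective j ∧ ∑ i : Fin k, ((j i.castSucc : ℝ) + 1) / N ≤ u - 1 ∧
      u - 1 ≤ ∑ i, (j i : ℝ) / N ∧ ∑ i, ((j i : ℝ) + 1) / N ≤ u - v := by
  simp [goodCells]

/-- The half-open box with sides `(jᵢ/N, (jᵢ+1)/N]`. -/
def box (N : ℕ) {k : ℕ} (j : Fin k → ℕ) : Set (Fin k → ℝ) :=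
  Set.univ.pi fun i => Set.Ioc ((j i : ℝ) / N) (((j i : ℝ) + 1) / N)

theorem measurableSet_box (N : ℕ) {k : ℕ} (j : Fin k → ℕ) : MeasurableSet (box N j) :=
  MeasurableSet.univ_pi fun _ => measurableSet_Ioc

theorem volume_box (N : ℕ) {k : ℕ} (j : Fin k → ℕ) :
    volume (box N j) = ENNReal.ofReal ((1 / N) ^ k) := by
  rw [box, Real.volume_pi_Ioc]
  simp only [← sub_div, add_sub_cancel_left]
  rw [← ENNReal.ofReal_prod_of_nonneg (fun i _ => by positivity)]
  simp

theorem eq_of_mem_cells {N : ℕ} (hN : 0 < N) {a b : ℕ} {x : ℝ}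
    (ha : x ∈ Set.Ioc ((a : ℝ) / N) (((a : ℝ) + 1) / N))
    (hb : x ∈ Set.Ioc ((b : ℝ) / N) (((b : ℝ) + 1) / N)) : a = b := by
  have hN' : (0 : ℝ) < N := by exact_mod_cast hN
  have h1 : (a : ℝ) < b + 1 := (div_lt_div_iff_of_pos_right hN').1 (ha.1.trans_le hb.2)
  have h2 : (b : ℝ) < a + 1 := (div_lt_div_iff_of_pos_right hN').1 (hb.1.trans_le ha.2)
  norm_cast at h1 h2
  lia

theorem disjoint_box {N : ℕ} (hN : 0 < N) {k : ℕ} {j j' : Fin k → ℕ} (h : j ≠ j') :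
    Disjoint (box N j) (box N j') :=
  Set.disjoint_left.2 fun _ hs hs' =>
    h (funext fun i => eq_of_mem_cells hN (hs i trivial) (hs' i trivial))

/-- The part of the cube where a point of `stopRegion` may fail to lie in a good cell. -/
def badSet (N M k : ℕ) (u v : ℝ) : Set (Fin (k + 1) → ℝ) :=
  (⋃ i, cube (k + 1) ∩ {t | t i ∈ Set.Icc (0 : ℝ) (0 + M / N)}) ∪
  (⋃ i, ⋃ l, if i = l then ∅ else
    cube (k + 1) ∩ {t | t i - t l ∈ Set.Icc (-(1 / N : ℝ)) (-(1 / N) + 2 / N)}) ∪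
  (if k = 0 then ∅ else cube (k + 1) ∩
    {t | ∑ i : Fin k, t i.castSucc ∈ Set.Icc (u - 1 - k / N) (u - 1 - k / N + k / N)}) ∪
  (cube (k + 1) ∩ {t | ∑ i, t i ∈ Set.Icc (u - 1) (u - 1 + (k + 1) / N)}) ∪
  (cube (k + 1) ∩
    {t | ∑ i, t i ∈ Set.Icc (u - v - (k + 1) / N) (u - v - (k + 1) / N + (k + 1) / N)})

/-- Each of the five families of slabs corresponds to one requirement on a good cell: indices at
least `M`, injectivity, and the three inequalities on sums. The thicknesses are `M / N` for the
first and `O_k(1/N)` for the others. -/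
theorem volume_badSet_le (N M k : ℕ) (u v : ℝ) : volume (badSet N M k u v) ≤
    ENNReal.ofReal ((k + 1) * (M / N) + (k + 1) * ((k + 1) * (2 / N)) + k / N + (k + 1) / N +
      (k + 1) / N) := by
  have hk : (0 : ℝ) ≤ k + 1 := by positivity
  rw [ENNReal.ofReal_add (by positivity) (by positivity),
    ENNReal.ofReal_add (by positivity) (by positivity),
    ENNReal.ofReal_add (by positivity) (by positivity),
    ENNReal.ofReal_add (by positivity) (by positivity)]
  have hcard : ENNReal.ofReal ((k : ℝ) + 1) = (Fintype.card (Fin (k + 1)) : ENNReal) := by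
    rw [Fintype.card_fin, ← ENNReal.ofReal_natCast]; push_cast; rfl
  have hsum : Measurable fun t : Fin (k + 1) → ℝ => ∑ i, t i := by fun_prop
  have hins : ∀ (x : ℝ) (s : Fin k → ℝ),
      ∑ i, ((0 : Fin (k + 1)).insertNth x s : Fin (k + 1) → ℝ) i =
        x + ∑ i, ((0 : Fin (k + 1)).insertNth 0 s : Fin (k + 1) → ℝ) i := by
    intro x s
    rw [Fin.sum_univ_succ, Fin.sum_univ_succ]
    simp
  refine (measure_union_le _ _).trans (add_le_add ?_ (volume_slab_le 0 hsum hins _ _))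
  refine (measure_union_le _ _).trans (add_le_add ?_ (volume_slab_le 0 hsum hins _ _))
  refine (measure_union_le _ _).trans (add_le_add ?_ ?_)
  · refine (measure_union_le _ _).trans (add_le_add ?_ ?_)
    · refine (measure_iUnion_fintype_le _ _).trans
        ((Finset.sum_le_sum fun i _ => volume_slab_le i (measurable_pi_apply i)
          (fun x s => by simp) _ _).trans_eq ?_)
      rw [Finset.sum_const, Finset.card_univ, nsmul_eq_mul, ENNReal.ofReal_mul hk, hcard]
    · have h1 : ∀ i l : Fin (k + 1), volume (if i = l then ∅ else cube (k + 1) ∩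
          {t : Fin (k + 1) → ℝ | t i - t l ∈ Set.Icc (-(1 / N : ℝ)) (-(1 / N) + 2 / N)}) ≤
          ENNReal.ofReal (2 / N) := by
        intro i l
        split_ifs with h
        · simp
        · obtain ⟨l', rfl⟩ := Fin.exists_succAbove_eq (Ne.symm h)
          exact volume_slab_le i (by fun_prop) (fun x s => by simp; ring) _ _
      have h2 : ∀ i : Fin (k + 1), volume (⋃ l, if i = l then ∅ else cube (k + 1) ∩
          {t : Fin (k + 1) → ℝ | t i - t l ∈ Set.Icc (-(1 / N : ℝ)) (-(1 / N) + 2 / N)}) ≤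
          ENNReal.ofReal ((k + 1) * (2 / N)) := fun i => by
        refine (measure_iUnion_fintype_le _ _).trans
          ((Finset.sum_le_sum fun l _ => h1 i l).trans_eq ?_)
        rw [Finset.sum_const, Finset.card_univ, nsmul_eq_mul, ENNReal.ofReal_mul hk, hcard]
      refine (measure_iUnion_fintype_le _ _).trans
          ((Finset.sum_le_sum fun l _ => h2 l).trans_eq ?_)
      simp only [Finset.sum_const, Finset.card_univ, nsmul_eq_mul, ENNReal.ofReal_mul hk, hcard]
  · split_ifs with h
    · simp
    · obtain ⟨k, rfl⟩ := Nat.exists_eq_succ_of_ne_zero h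
      refine volume_slab_le 0 (by fun_prop) (fun x s => ?_) _ _
      rw [Fin.sum_univ_succ, Fin.sum_univ_succ]
      simp

theorem exists_cell {N : ℕ} (hN : 0 < N) {x : ℝ} (hx : x ∈ Set.Ioo (0 : ℝ) 1) :
    ∃ j : ℕ, j < N ∧ x ∈ Set.Ioc ((j : ℝ) / N) (((j : ℝ) + 1) / N) := by
  have hN' : (0 : ℝ) < N := by exact_mod_cast hN
  have hpos : 0 < ⌈N * x⌉₊ := Nat.ceil_pos.2 (mul_pos hN' hx.1)
  obtain ⟨j, hj⟩ := Nat.exists_eq_succ_of_ne_zero hpos.ne'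
  have h1 : (j : ℝ) < N * x := Nat.lt_ceil.1 (by lia)
  have h2 : N * x ≤ (j : ℝ) + 1 := by
    have := Nat.le_ceil (N * x)
    rw [hj] at this
    exact_mod_cast this
  refine ⟨j, ?_, ?_, ?_⟩
  · have : (j : ℝ) < N := h1.trans_le (by nlinarith [hx.2])
    exact_mod_cast this
  · rw [div_lt_iff₀ hN']; linarith
  · rw [le_div_iff₀ hN']; linarith

/-- A point and the corners of its cell differ by at most `1/N` per coordinate, so a requirement
that fails for the cell puts the point in the matching slab. -/
theorem stopRegion_subset {N M k : ℕ} (hN : 0 < N) (u v : ℝ) :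
    stopRegion k u v ⊆ badSet N M k u v ∪ ⋃ j ∈ goodCells N M k u v, box N j := by
  intro t ht
  by_cases hb : t ∈ badSet N M k u v
  · exact Or.inl hb
  right
  have hN' : (0 : ℝ) < N := by exact_mod_cast hN
  have htc := stopRegion_subset_cube k u v ht
  choose j hjN hj using fun i => exists_cell hN (ht.1 i)
  have hle : ∀ i, t i ≤ (j i + 1) / N := fun i => (hj i).2
  have hlt : ∀ i, (j i : ℝ) / N < t i := fun i => (hj i).1
  simp only [badSet, Set.mem_union, not_or] at hb
  obtain ⟨⟨⟨⟨hb1, hb2⟩, hb3⟩, hb4⟩, hb5⟩ := hb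
  refine Set.mem_biUnion (x := j) (mem_goodCells.2 ⟨fun i => ⟨?_, hjN i⟩, ?_, ?_, ?_, ?_⟩)
    fun i _ => hj i
  · by_contra! hlt'
    refine hb1 (Set.mem_iUnion.2 ⟨i, htc, (ht.1 i).1.le, ?_⟩)
    rw [zero_add]
    refine (hle i).trans (div_le_div_of_nonneg_right ?_ hN'.le)
    exact_mod_cast hlt'
  · intro i l hil
    by_contra hne
    refine hb2 (Set.mem_iUnion.2 ⟨i, Set.mem_iUnion.2 ⟨l, ?_⟩⟩)
    rw [if_neg hne]
    have h1 := hle i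
    have h2 := hlt l
    have h3 := hle l
    have h4 := hlt i
    rw [hil] at h1 h4
    rw [add_div] at h1 h3
    refine ⟨htc, ?_, ?_⟩
    · linarith
    · have : (2 : ℝ) / N = 1 / N + 1 / N := by ring
      rw [this]; linarith
  -- For `k = 0` the sum is empty and does not depend on the cell, so nothing is lost.
  · by_cases hk : k = 0
    · subst hk
      simpa using ht.2.1
    · rw [if_neg hk] at hb3
      by_contra! hgt
      refine hb3 ⟨htc, ?_, by linarith [ht.2.1]⟩
      have : ∑ i : Fin k, ((j i.castSucc : ℝ) + 1) / N ≤
          ∑ i : Fin k, (t i.castSucc + 1 / N) :=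
        Finset.sum_le_sum fun i _ => by rw [add_div]; linarith [hlt i.castSucc]
      rw [Finset.sum_add_distrib] at this
      simp only [Finset.sum_const, Finset.card_univ, Fintype.card_fin, nsmul_eq_mul] at this
      rw [mul_one_div] at this
      linarith
  · by_contra! hgt
    refine hb4 ⟨htc, ht.2.2.1.le, ?_⟩
    have : ∑ i, t i ≤ ∑ i, ((j i : ℝ) / N + 1 / N) :=
      Finset.sum_le_sum fun i _ => by rw [← add_div]; exact hle i
    rw [Finset.sum_add_distrib] at this
    simp only [Finset.sum_const, Finset.card_univ, Fintype.card_fin, nsmul_eq_mul] at this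
    rw [mul_one_div] at this
    push_cast at this
    linarith
  · by_contra! hgt
    refine hb5 ⟨htc, ?_, by linarith [ht.2.2.2]⟩
    have : ∑ i, ((j i : ℝ) + 1) / N ≤ ∑ i, (t i + 1 / N) :=
      Finset.sum_le_sum fun i _ => by rw [add_div]; linarith [hlt i]
    rw [Finset.sum_add_distrib] at this
    simp only [Finset.sum_const, Finset.card_univ, Fintype.card_fin, nsmul_eq_mul] at this
    rw [mul_one_div] at this
    push_cast at this
    linarith

/-- Longer pieces shorten what remains and so enlarge each factor. Hence upper corners bound `stick`
from above on a cell, and lower corners from below. -/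
theorem stick_mono {k : ℕ} {u : ℝ} {s t : Fin (k + 1) → ℝ} (hs : ∀ i, 0 ≤ s i)
    (hst : ∀ i, s i ≤ t i) (h : ∑ i : Fin k, t i.castSucc ≤ u - 1) :
    stick (k + 1) u s ≤ stick (k + 1) u t := by
  have ht : ∀ i, 0 ≤ t i := fun i => (hs i).trans (hst i)
  have hs' : ∑ i : Fin k, s i.castSucc ≤ u - 1 :=
    (Finset.sum_le_sum fun i _ => hst _).trans h
  refine Finset.prod_le_prod
    (fun i _ => inv_nonneg.2 (zero_le_one.trans (one_le_sub_partialSum hs hs' i))) fun i _ => ?_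
  refine inv_anti₀ (one_pos.trans_le (one_le_sub_partialSum ht h i)) ?_
  refine sub_le_sub_left (Finset.sum_le_sum fun l _ => ?_) _
  split_ifs
  exacts [hst l, le_rfl]

theorem setIntegral_box_le {N M k : ℕ} {u v : ℝ} {j : Fin (k + 1) → ℕ}
    (hj : j ∈ goodCells N M k u v) :
    IntegrableOn (stick (k + 1) u) (box N j) ∧ (∀ t ∈ box N j, 0 ≤ stick (k + 1) u t) ∧
    ∫ t in box N j, stick (k + 1) u t ≤
      stick (k + 1) u (fun i => ((j i : ℝ) + 1) / N) * (1 / N) ^ (k + 1) := by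
  have hsum := (mem_goodCells.1 hj).2.2.1
  have h0 : ∀ t ∈ box N j, ∀ i, 0 ≤ t i := fun t ht i =>
    (by positivity : (0 : ℝ) ≤ j i / N).trans (ht i trivial).1.le
  have hts : ∀ t ∈ box N j, ∑ i : Fin k, t i.castSucc ≤ u - 1 := fun t ht =>
    (Finset.sum_le_sum fun i _ => (ht _ trivial).2).trans hsum
  have hle : ∀ t ∈ box N j, stick (k + 1) u t ≤ stick (k + 1) u fun i => ((j i : ℝ) + 1) / N :=
    fun t ht => stick_mono (h0 t ht) (fun i => (ht i trivial).2) hsum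
  have hpos : ∀ t ∈ box N j, 0 ≤ stick (k + 1) u t := fun t ht =>
    (stick_pos (h0 t ht) (hts t ht)).le
  have hfin : volume (box N j) ≠ ⊤ := by rw [volume_box]; exact ENNReal.ofReal_ne_top
  have hint : IntegrableOn (stick (k + 1) u) (box N j) := by
    refine Measure.integrableOn_of_bounded (M := 1) hfin
      (measurable_stick_right _ _).aestronglyMeasurable ?_
    filter_upwards [ae_restrict_mem (measurableSet_box N j)] with t ht
    rw [Real.norm_of_nonneg (hpos t ht)]
    exact stick_le_one (h0 t ht) (hts t ht)
  refine ⟨hint, hpos, ?_⟩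
  refine (setIntegral_mono_on hint (integrableOn_const hfin) (measurableSet_box N j) hle).trans_eq ?_
  rw [setIntegral_const, Measure.real, volume_box, ENNReal.toReal_ofReal (by positivity),
    smul_eq_mul, mul_comm]

/-- Since `stick ≤ 1`, the points outside good cells cost at most the volume of `badSet`. -/
theorem muK_le_sum_goodCells {N M k : ℕ} (hN : 0 < N) {u : ℝ} (hu : 1 ≤ u) (v : ℝ) :
    muK (k + 1) u v ≤ ((k + 1) * (M / N) + (k + 1) * ((k + 1) * (2 / N)) + k / N + (k + 1) / N +
      (k + 1) / N) + ∑ j ∈ goodCells N M k u v,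
        stick (k + 1) u (fun i => ((j i : ℝ) + 1) / N) * (1 / N) ^ (k + 1) := by
  refine (muK_le_integral hu).trans ?_
  set G := ⋃ j ∈ goodCells N M k u v, box N j
  have hGm : MeasurableSet G := Finset.measurableSet_biUnion _ fun j _ => measurableSet_box N j
  rw [← integral_inter_add_sdiff hGm integrableOn_stick, add_comm]
  have hWm := measurableSet_stopRegion k u v
  refine add_le_add ?_ ?_
  · have hv : volume (stopRegion k u v \ G) ≤ _ :=
      (measure_mono fun t ht => ((stopRegion_subset hN u v) ht.1).resolve_right ht.2).trans
        (volume_badSet_le N M k u v)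
    calc ∫ t in stopRegion k u v \ G, stick (k + 1) u t
        ≤ ∫ t in stopRegion k u v \ G, (1 : ℝ) :=
          setIntegral_mono_on (integrableOn_stick.mono_set Set.sdiff_subset)
            (integrableOn_const (hv.trans_lt ENNReal.ofReal_lt_top).ne) (hWm.diff hGm)
            fun t ht => (stick_mem_of_mem_stopRegion ht.1).2
      _ ≤ _ := by
          rw [setIntegral_const, smul_eq_mul, mul_one, Measure.real]
          exact ENNReal.toReal_le_of_le_ofReal (by positivity) hv
  · have hd : ((goodCells N M k u v : Finset _) : Set (Fin (k + 1) → ℕ)).Pairwise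
        (Function.onFun Disjoint (box N)) := fun j _ j' _ h => disjoint_box hN h
    have hint : ∀ j ∈ goodCells N M k u v, IntegrableOn (stick (k + 1) u) (box N j) :=
      fun j hj => (setIntegral_box_le hj).1
    calc ∫ t in stopRegion k u v ∩ G, stick (k + 1) u t ≤ ∫ t in G, stick (k + 1) u t := by
          refine setIntegral_mono_set ((integrableOn_finset_iUnion).2 hint) ?_
            Set.inter_subset_right.eventuallyLE
          filter_upwards [ae_restrict_mem hGm] with t ht
          obtain ⟨j, hj, ht⟩ := Set.mem_iUnion₂.1 ht
          exact (setIntegral_box_le hj).2.1 t ht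
      _ = ∑ j ∈ goodCells N M k u v, ∫ t in box N j, stick (k + 1) u t :=
          integral_biUnion_finset _ (fun j _ => measurableSet_box N j) hd hint
      _ ≤ _ := Finset.sum_le_sum fun j hj => (setIntegral_box_le hj).2.2

/-! ### Lower Riemann sums for `μ_k` -/

/-- A lower bound on the box for the weight of a tuple of primes. -/
noncomputable def cellWeight (N : ℕ) {k : ℕ} (u : ℝ) (j : Fin (k + 1) → ℕ) : ℝ :=
  (∏ i, (j i : ℝ) / N) * stick (k + 1) u fun i => (j i : ℝ) / N

/-- Passing from upper to lower corners costs a factor close to `1` per coordinate: `j / (j + 1) ≥ M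
/ (M + 1)`, and a denominator grows by at most `k / N`, that is by a ratio at most `(N + k) / N`
because it is at least `1`. -/
theorem le_cellWeight {N M k : ℕ} (hN : 0 < N) {u v : ℝ} {j : Fin (k + 1) → ℕ}
    (hj : j ∈ goodCells N M k u v) :
    ((M / (M + 1) : ℝ) * (N / (N + k))) ^ (k + 1) *
      (stick (k + 1) u (fun i => ((j i : ℝ) + 1) / N) * (1 / N) ^ (k + 1)) ≤
      cellWeight N u j * ∏ i, 1 / ((j i : ℝ) + 1) := by
  have hN' : (0 : ℝ) < N := by exact_mod_cast hN
  obtain ⟨hjM, -, hs, -⟩ := mem_goodCells.1 hj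
  have h0 : ∀ i, (0 : ℝ) ≤ ((j i : ℝ) + 1) / N := fun i => by positivity
  rw [cellWeight, stick, stick, mul_right_comm, ← Finset.prod_mul_distrib,
    ← Finset.prod_mul_distrib]
  have hcst : ∀ x : ℝ, x ^ (k + 1) = ∏ _i : Fin (k + 1), x := by simp
  rw [hcst, hcst, ← Finset.prod_mul_distrib, ← Finset.prod_mul_distrib]
  have hD : ∀ i : Fin (k + 1), 1 ≤ u - ∑ l, (if l < i then ((j l : ℝ) + 1) / N else 0) :=
    one_le_sub_partialSum (t := fun i => ((j i : ℝ) + 1) / N) h0 hs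
  refine Finset.prod_le_prod (fun i _ => ?_) fun i _ => ?_
  · have := zero_lt_one.trans_le (hD i)
    positivity
  set D := u - ∑ l, (if l < i then ((j l : ℝ) + 1) / N else 0) with hDdef
  have hDi : 1 ≤ D := hD i
  set D' := u - ∑ l, (if l < i then (j l : ℝ) / N else 0) with hD'def
  have hD' : D' ≤ D * ((N + k) / N) := by
    have h1 : ∑ l, (if l < i then ((j l : ℝ) + 1) / N else 0) ≤
        ∑ l, (if l < i then (j l : ℝ) / N else 0) + k / N := by
      rw [Fin.sum_univ_castSucc, Fin.sum_univ_castSucc, if_neg (Fin.le_last i).not_gt,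
        if_neg (Fin.le_last i).not_gt, add_zero, add_zero]
      have : (k : ℝ) / N = ∑ _l : Fin k, (1 : ℝ) / N := by
        simp [div_eq_mul_inv]
      rw [this, ← Finset.sum_add_distrib]
      refine Finset.sum_le_sum fun l _ => ?_
      split_ifs
      · rw [add_div]
      · positivity
    have h2 : D' ≤ D + k / N := by linarith
    have h3 : D * ((N + k) / N) = D + D * (k / N) := by field_simp
    have h4 : (k : ℝ) / N ≤ D * (k / N) := le_mul_of_one_le_left (by positivity) hDi
    linarith
  have hD'1 : D ≤ D' := by
    refine sub_le_sub_left (Finset.sum_le_sum fun l _ => ?_) _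
    split_ifs
    · gcongr; linarith
    · exact le_rfl
  have hDpos : 0 < D := by linarith
  have hD'pos : 0 < D' := by linarith
  have e1 : (M / (M + 1) : ℝ) ≤ j i / (j i + 1) := by
    have : (M : ℝ) ≤ j i := by exact_mod_cast (hjM i).1
    rw [div_le_div_iff₀ (by positivity) (by positivity)]
    linarith
  have e2 : (N / (N + k) : ℝ) * D⁻¹ ≤ D'⁻¹ := by
    rw [← one_div D', le_div_iff₀ hD'pos]
    calc (N / (N + k) : ℝ) * D⁻¹ * D' ≤ (N / (N + k) : ℝ) * D⁻¹ * (D * ((N + k) / N)) := by gcongr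
      _ = 1 := by field_simp
  calc (M / (M + 1) : ℝ) * (N / (N + k)) * (D⁻¹ * (1 / N))
      = (M / (M + 1) : ℝ) * ((N / (N + k)) * D⁻¹) * (1 / N) := by ring
    _ ≤ (j i / (j i + 1)) * D'⁻¹ * (1 / N) := by gcongr
    _ = _ := by ring

/-- Uniform approximation of `μ_k` from below by sums over good cells. -/
theorem eventually_muK_sub_le (k : ℕ) {ε : ℝ} (hε : 0 < ε) :
    ∀ᶠ M : ℕ in atTop, ∀ u v : ℝ, 1 ≤ u → muK (k + 1) u v - ε ≤
      ∑ j ∈ goodCells (M * M) M k u v,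
        cellWeight (M * M) u j * ∏ i, 1 / ((j i : ℝ) + 1) := by
  -- With `N = M * M`, the cut-off `M / N = 1 / M` and all the other losses tend to `0` together.
  have hinv : Tendsto (fun M : ℕ => (1 : ℝ) / M) atTop (𝓝 0) := tendsto_one_div_atTop_nhds_zero_nat
  have hlam : Tendsto (fun M : ℕ => ((1 / (1 + 1 / (M : ℝ))) *
      (1 / (1 + k * (1 / M * (1 / M))))) ^ (k + 1)) atTop (𝓝 1) := by
    have : Tendsto (fun M : ℕ => ((1 / (1 + 1 / (M : ℝ))) *
      (1 / (1 + k * (1 / M * (1 / M))))) ^ (k + 1)) atTop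
      (𝓝 (((1 / (1 + 0)) * (1 / (1 + k * (0 * 0)))) ^ (k + 1) : ℝ)) := by
      refine Tendsto.pow (Tendsto.mul ?_ ?_) _
      · exact tendsto_const_nhds.div (tendsto_const_nhds.add hinv) (by norm_num)
      · exact tendsto_const_nhds.div
          (tendsto_const_nhds.add (tendsto_const_nhds.mul (hinv.mul hinv))) (by norm_num)
    simpa using this
  have hbad : Tendsto (fun M : ℕ => ((k : ℝ) + 1) * (1 / M) +
      ((k + 1) * ((k + 1) * 2) + k + (k + 1) + (k + 1)) * (1 / M * (1 / M))) atTop (𝓝 0) := by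
    have := (hinv.const_mul ((k : ℝ) + 1)).add
      ((hinv.mul hinv).const_mul (((k : ℝ) + 1) * ((k + 1) * 2) + k + (k + 1) + (k + 1)))
    simpa using this
  filter_upwards [hlam.eventually (lt_mem_nhds (by linarith : 1 - ε / 2 < 1)),
    hbad.eventually_lt_const (half_pos hε), eventually_gt_atTop 0] with M h1 h2 hM u v hu
  have hM' : (0 : ℝ) < M := by exact_mod_cast hM
  have hmain := muK_le_sum_goodCells (N := M * M) (M := M) (k := k) (by positivity) hu v
  set lam := ((M / (M + 1) : ℝ) * ((M * M : ℕ) / ((M * M : ℕ) + k))) ^ (k + 1) with hlamdef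
  have hlam1 : lam = ((1 / (1 + 1 / (M : ℝ))) * (1 / (1 + k * (1 / M * (1 / M))))) ^ (k + 1) := by
    rw [hlamdef]
    push_cast
    congr 1
    field_simp
  have hlampos : 0 ≤ lam := by rw [hlamdef]; positivity
  have hlamle : lam ≤ 1 := by
    rw [hlamdef]
    refine pow_le_one₀ (by positivity) (mul_le_one₀ ?_ (by positivity) ?_)
    · exact div_le_one_of_le₀ (by linarith) (by linarith)
    · exact div_le_one_of_le₀ (by linarith [(k.cast_nonneg : (0 : ℝ) ≤ k)]) (by positivity)
  rw [← hlam1] at h1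
  set b := ((k : ℝ) + 1) * (M / (M * M : ℕ)) + (k + 1) * ((k + 1) * (2 / (M * M : ℕ))) +
    k / (M * M : ℕ) + (k + 1) / (M * M : ℕ) + (k + 1) / (M * M : ℕ) with hb
  have hb1 : b = ((k : ℝ) + 1) * (1 / M) +
      ((k + 1) * ((k + 1) * 2) + k + (k + 1) + (k + 1)) * (1 / M * (1 / M)) := by
    rw [hb]
    push_cast
    field_simp
    ring
  rw [← hb1] at h2
  have hb0 : 0 ≤ b := by rw [hb]; positivity
  have hmu1 : muK (k + 1) u v ≤ 1 := muK_le_one hu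
  have hmu0 : 0 ≤ muK (k + 1) u v := muK_nonneg hu
  -- From `lam > 1 - ε / 2`, `b < ε / 2`, `lam ≤ 1` and `0 ≤ μ ≤ 1`.
  calc muK (k + 1) u v - ε ≤ lam * (muK (k + 1) u v - b) := by nlinarith
    _ ≤ lam * ∑ j ∈ goodCells (M * M) M k u v,
        stick (k + 1) u (fun i => ((j i : ℝ) + 1) / (M * M : ℕ)) * (1 / (M * M : ℕ)) ^ (k + 1) :=
        mul_le_mul_of_nonneg_left (by linarith) hlampos
    _ ≤ _ := by
        rw [Finset.mul_sum]
        exact Finset.sum_le_sum fun j hj => le_cellWeight (by positivity) hj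

/-! ### Convergence and positivity of the series -/

theorem integral_majorant (B v u : ℝ) (K : ℕ) :
    ∫ t in (0 : ℝ)..(u - 1), (B * (u - t - 1) ^ K / K.factorial + v * (u - t)) =
      B * (u - 1) ^ (K + 1) / (K + 1).factorial + v * ((u ^ 2 - 1) / 2) := by
  have hd : ∀ t ∈ Set.uIcc 0 (u - 1), HasDerivAt
      (fun t => -(B * (u - t - 1) ^ (K + 1) / (K + 1).factorial) - v * ((u - t) ^ 2 / 2))
      (B * (u - t - 1) ^ K / K.factorial + v * (u - t)) t := by
    intro t _
    have h1 : HasDerivAt (fun t : ℝ => u - t) (-1) t := by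
      simpa using (hasDerivAt_id t).const_sub u
    have h2 := ((((h1.sub_const 1).pow (K + 1)).const_mul B).div_const
      ((K + 1).factorial : ℝ)).neg.sub ((((h1.pow 2).div_const 2)).const_mul v)
    refine h2.congr_deriv ?_
    rw [Nat.factorial_succ]
    push_cast
    have : (K.factorial : ℝ) ≠ 0 := by exact_mod_cast K.factorial_ne_zero
    have : (K : ℝ) + 1 ≠ 0 := by positivity
    field_simp
    ring
  rw [intervalIntegral.integral_eq_sub_of_hasDerivAt hd
    (Continuous.intervalIntegrable (by fun_prop) _ _)]
  simp
  ring

/-- The inductive engine for `muK_recursion`: one integration raises `K` by one and keeps the shape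
of the majorant. The factorial bound on `muK` takes `v = 0`; the comparison with `ϱ` uses both
terms. -/
theorem abs_setIntegral_le {f : ℝ → ℝ} {B v u : ℝ} (K : ℕ) (hB : 0 ≤ B) (hv : 0 ≤ v) (hu : 1 ≤ u)
    (h : ∀ t ∈ Set.Ioo (0 : ℝ) 1 ∩ Set.Iio (u - 1),
      |f t| ≤ B * (u - t - 1) ^ K / K.factorial + v * (u - t)) :
    |∫ t in Set.Ioo (0 : ℝ) 1 ∩ Set.Iio (u - 1), f t| ≤
      B * (u - 1) ^ (K + 1) / (K + 1).factorial + v * ((u ^ 2 - 1) / 2) := by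
  set J := Set.Ioo (0 : ℝ) 1 ∩ Set.Iio (u - 1)
  have hJm : MeasurableSet J := measurableSet_Ioo.inter measurableSet_Iio
  have hsub : J ⊆ Set.Ioc 0 (u - 1) := fun t ht => ⟨ht.1.1, (show t < u - 1 from ht.2).le⟩
  have hint : IntegrableOn (fun t => B * (u - t - 1) ^ K / K.factorial + v * (u - t))
      (Set.Ioc 0 (u - 1)) :=
    ((Continuous.intervalIntegrable (by fun_prop) 0 (u - 1) :
      IntervalIntegrable (fun t => B * (u - t - 1) ^ K / K.factorial + v * (u - t)) volume _ _)).1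
  rw [← integral_majorant, intervalIntegral.integral_of_le (by linarith)]
  have hle : ∫ t in J, (B * (u - t - 1) ^ K / K.factorial + v * (u - t)) ≤
      ∫ t in Set.Ioc 0 (u - 1), (B * (u - t - 1) ^ K / K.factorial + v * (u - t)) := by
    refine setIntegral_mono_set hint ?_ hsub.eventuallyLE
    filter_upwards [ae_restrict_mem measurableSet_Ioc] with t ht
    have h1 : 0 ≤ u - t - 1 := by linarith [ht.2]
    have h2 : 0 ≤ u - t := by linarith
    simp only [Pi.zero_apply]
    positivity
  rw [← Real.norm_eq_abs]
  refine le_trans (norm_integral_le_of_norm_le (hint.mono_set hsub) ?_) hle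
  filter_upwards [ae_restrict_mem hJm] with t ht
  exact h t ht

theorem muK_le_pow_div_factorial (k : ℕ) (v : ℝ) :
    ∀ u : ℝ, 1 ≤ u → muK (k + 1) u v ≤ (u - 1) ^ k / k.factorial := by
  induction k with
  | zero => intro u hu; simpa using muK_le_one hu
  | succ k ih =>
    intro u hu
    rw [(muK_recursion k u v).2]
    have := abs_setIntegral_le (f := fun t => muK (k + 1) (u - t) v) (B := 1) (v := 0) k zero_le_one
      le_rfl hu fun t ht => by
        have h1 : 1 ≤ u - t := by have : t < u - 1 := ht.2; linarith
        rw [abs_of_nonneg (muK_nonneg h1)]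
        simpa using ih _ h1
    simp only [one_mul, zero_mul, add_zero] at this
    have hp : 0 ≤ (u - 1) ^ (k + 1) / (k + 1).factorial :=
      div_nonneg (pow_nonneg (by linarith) _) (by positivity)
    calc 1 / u * ∫ t in Set.Ioo (0 : ℝ) 1 ∩ Set.Iio (u - 1), muK (k + 1) (u - t) v
        ≤ 1 / u * ((u - 1) ^ (k + 1) / (k + 1).factorial) :=
          mul_le_mul_of_nonneg_left ((le_abs_self _).trans this) (by positivity)
      _ ≤ _ := mul_le_of_le_one_left hp ((div_le_one (by linarith)).2 hu)

theorem muTerm_le {κ u u₀ : ℝ} (hκ : 0 < κ) (v : ℝ) (hu : 1 ≤ u) (hu₀ : u ≤ u₀) (k : ℕ) :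
    κ ^ (k + 1) * muK (k + 1) u v ≤ κ * ((κ * u₀) ^ k / k.factorial) := by
  have h1 : muK (k + 1) u v ≤ u₀ ^ k / k.factorial :=
    (muK_le_pow_div_factorial k v u hu).trans (by gcongr; linarith)
  calc κ ^ (k + 1) * muK (k + 1) u v ≤ κ ^ (k + 1) * (u₀ ^ k / k.factorial) := by gcongr
    _ = _ := by rw [mul_pow]; ring

theorem summable_majorant (κ u₀ : ℝ) :
    Summable fun k : ℕ => κ * ((κ * u₀) ^ k / k.factorial) :=
  (Real.summable_pow_div_factorial _).mul_left κ

theorem summable_muTerm {κ u : ℝ} (hκ : 0 < κ) (v : ℝ) (hu : 1 ≤ u) :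
    Summable fun k : ℕ => κ ^ (k + 1) * muK (k + 1) u v :=
  Summable.of_nonneg_of_le (fun _ => mul_nonneg (by positivity) (muK_nonneg hu))
    (muTerm_le hκ v hu le_rfl) (summable_majorant κ u)

/-- For `k = ⌊u⌋ - 1`, a first piece `t ∈ (u - k - 1, 1)` lowers `⌊u⌋` by one, so the recursion
integrates a positive function over an interval of positive length; the base case uses `v < 1`. -/
theorem muK_pos {v : ℝ} (hv : v < 1) (k : ℕ) :
    ∀ u : ℝ, (k : ℝ) + 1 ≤ u → u < k + 2 → 0 < muK (k + 1) u v := by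
  induction k with
  | zero =>
    intro u h1 h2
    simp only [Nat.cast_zero, zero_add] at h1 h2
    have hu0 : 0 < u := by linarith
    rw [muK, Set.Ioo_inter_Ioo, Real.volume_Ioo, ENNReal.toReal_ofReal']
    refine mul_pos (by positivity) (lt_max_of_lt_left (sub_pos.2 ?_))
    rw [lt_inf_iff, sup_lt_iff, sup_lt_iff]
    exact ⟨⟨one_pos, by linarith⟩, by linarith, by linarith⟩
  | succ k ih =>
    intro u h1 h2
    push_cast at h1 h2
    have hk : (0 : ℝ) ≤ k := k.cast_nonneg
    have hu0 : 0 < u := by linarith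
    rw [(muK_recursion k u v).2]
    refine mul_pos (by positivity) ?_
    have hJm : MeasurableSet (Set.Ioo (0 : ℝ) 1 ∩ Set.Iio (u - 1)) :=
      measurableSet_Ioo.inter measurableSet_Iio
    rw [setIntegral_pos_iff_support_of_nonneg_ae ?_ (muK_recursion k u v).1]
    · refine (?_ : 0 < volume (Set.Ioo (u - k - 2) 1)).trans_le (measure_mono fun t ht => ?_)
      · rw [Real.volume_Ioo, ENNReal.ofReal_pos]
        linarith
      · have ht1 := ht.1
        have ht2 := ht.2
        exact ⟨(ih (u - t) (by linarith) (by linarith)).ne',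
          ⟨by linarith, ht2⟩, show t < u - 1 by linarith⟩
    · filter_upwards [ae_restrict_mem hJm] with t ht
      have : t < u - 1 := ht.2
      exact muK_nonneg (by linarith)

theorem muSeries_pos {κ u v : ℝ} (hκ : 0 < κ) (hu : 1 ≤ u) (hv : v < 1) : 0 < muSeries κ u v := by
  have h1 : 1 ≤ ⌊u⌋₊ := Nat.le_floor (by simpa using hu)
  obtain ⟨k, hk⟩ := Nat.exists_eq_succ_of_ne_zero (by lia : ⌊u⌋₊ ≠ 0)
  have h2 := Nat.floor_le (by linarith : 0 ≤ u)
  have h3 := Nat.lt_floor_add_one u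
  rw [hk] at h2 h3
  push_cast at h2 h3
  exact (summable_muTerm hκ v hu).tsum_pos
    (fun _ => mul_nonneg (by positivity) (muK_nonneg hu)) k
    (mul_pos (by positivity) (muK_pos hv k u h2 (by linarith)))

/-! ### Comparison with the Dickman function -/

/-- Both sides equal `1` at `u = 1`, and by the differential equation their difference has zero
derivative beyond. -/
theorem mul_dickman_eq_integral {u : ℝ} (hu : 1 ≤ u) :
    u * dickman u = ∫ t in (u - 1)..u, dickman t := by
  have hii : ∀ a b, IntervalIntegrable dickman volume a b := fun a b =>
    continuous_dickman.intervalIntegrable a b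
  set P : ℝ → ℝ := fun w => ∫ t in (0 : ℝ)..w, dickman t with hP
  have hPd : ∀ w, HasDerivAt P (dickman w) w := fun w =>
    intervalIntegral.integral_hasDerivAt_right (hii _ _)
      (continuous_dickman.stronglyMeasurableAtFilter _ _) continuous_dickman.continuousAt
  have hPc : Continuous P := continuous_iff_continuousAt.2 fun w => (hPd w).continuousAt
  have hPs : ∀ w, ∫ t in (w - 1)..w, dickman t = P w - P (w - 1) := fun w =>
    (intervalIntegral.integral_interval_sub_left (hii _ _) (hii _ _)).symm
  rw [hPs]
  set h : ℝ → ℝ := fun w => w * dickman w - (P w - P (w - 1)) with hh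
  have h1 : h 1 = 0 := by
    have : P 1 = 1 := by
      simp only [hP]
      rw [intervalIntegral.integral_congr (g := fun _ => (1 : ℝ))]
      · simp
      · intro t ht
        rw [Set.uIcc_of_le zero_le_one] at ht
        exact dickman_of_le_one ht.2
    simp only [hh, this, sub_self, dickman_of_le_one le_rfl]
    simp [hP]
  rcases hu.eq_or_lt with rfl | hu
  · exact sub_eq_zero.1 h1
  have hc : ContinuousOn h (Set.Icc 1 u) := Continuous.continuousOn
    ((continuous_id.mul continuous_dickman).sub
      (hPc.sub (hPc.comp (continuous_id.sub continuous_const))))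
  have hder : ∀ w ∈ Set.Ioo 1 u, HasDerivAt h 0 w := by
    intro w hw
    have hw1 : 1 < w := hw.1
    have e := ((hasDerivAt_id w).mul (hasDerivAt_dickman hw1)).sub
      ((hPd w).sub ((hPd (w - 1)).comp_sub_const w 1))
    refine e.congr_deriv ?_
    have : w ≠ 0 := by linarith
    simp only [id]
    field_simp
    ring
  obtain ⟨c, -, hc⟩ := exists_hasDerivAt_eq_slope h (fun _ => 0) hu hc hder
  have hne : u - 1 ≠ 0 := by linarith
  rw [h1, sub_zero, eq_comm, div_eq_zero_iff, or_iff_left hne] at hc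
  exact sub_eq_zero.1 hc

/-- The partial sums and `ϱ` satisfy the same integral recursion, up to the defect `|S| - |T| ≤ v`
caused by the constraint `t < u - v`. In the inductive step `v(u² - 1)/2 + v ≤ v u²`, and division
by `u` restores the term `v u`. -/
theorem abs_dickman_sub_sum_le {B U v : ℝ} (hB : ∀ w ∈ Set.Icc 1 U, |dickman w| ≤ B) (hv : 0 ≤ v)
    (K : ℕ) : ∀ u ∈ Set.Icc 1 U, |dickman u - ∑ k ∈ Finset.range K, muK (k + 1) u v| ≤
      B * (u - 1) ^ K / K.factorial + v * u := by
  induction K with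
  | zero =>
    intro u hu
    have := hu.1
    simp only [Finset.range_zero, Finset.sum_empty, sub_zero, pow_zero, mul_one, Nat.factorial_zero,
      Nat.cast_one, div_one]
    have := hB u hu
    nlinarith
  | succ K ih =>
    intro u hu
    obtain ⟨hu1, huU⟩ := hu
    have hu0 : 0 < u := by linarith
    have hB0 : 0 ≤ B := (abs_nonneg _).trans (hB u ⟨hu1, huU⟩)
    set J := Set.Ioo (0 : ℝ) 1 ∩ Set.Iio (u - 1)
    set T := Set.Ioo (0 : ℝ) 1 ∩ Set.Ioo (u - 1) (u - v)
    have hTm : MeasurableSet T := measurableSet_Ioo.inter measurableSet_Ioo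
    set S := Set.Ioo (0 : ℝ) 1 \ Set.Iio (u - 1)
    have hSm : MeasurableSet S := measurableSet_Ioo.diff measurableSet_Iio
    have hSfin : volume S ≠ ⊤ := ((measure_mono Set.sdiff_subset).trans_lt (by simp)).ne
    -- the functional equation of the Dickman function
    have hc : Continuous fun t => dickman (u - t) := continuous_dickman.comp (by fun_prop)
    have hio : IntegrableOn (fun t => dickman (u - t)) (Set.Ioo 0 1) :=
      (hc.integrableOn_Icc).mono_set Set.Ioo_subset_Icc_self
    have e1 : u * dickman u = (∫ t in J, dickman (u - t)) + volume.real S := by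
      rw [mul_dickman_eq_integral hu1]
      have : ∫ t in (u - 1)..u, dickman t = ∫ t in (0 : ℝ)..1, dickman (u - t) := by
        rw [intervalIntegral.integral_comp_sub_left (fun t => dickman t) u, sub_zero]
      rw [this, intervalIntegral.integral_of_le zero_le_one, integral_Ioc_eq_integral_Ioo,
        ← integral_inter_add_sdiff measurableSet_Iio hio]
      congr 1
      rw [setIntegral_congr_fun (g := fun _ => (1 : ℝ)) hSm fun t ht =>
        dickman_of_le_one (by have : ¬ t < u - 1 := ht.2; linarith)]
      simp
    -- the recursion for the partial sums
    have e2 : u * ∑ k ∈ Finset.range (K + 1), muK (k + 1) u v =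
        (∫ t in J, ∑ k ∈ Finset.range K, muK (k + 1) (u - t) v) + volume.real T := by
      rw [integral_finsetSum _ fun k _ => (muK_recursion k u v).1, Finset.sum_range_succ', mul_add,
        Finset.mul_sum]
      congr 1
      · refine Finset.sum_congr rfl fun k _ => ?_
        rw [(muK_recursion k u v).2]
        field_simp
      · simp only [muK]
        rw [← mul_assoc, mul_one_div_cancel hu0.ne', one_mul]
        rfl
    have hD : IntegrableOn (fun t => ∑ k ∈ Finset.range K, muK (k + 1) (u - t) v) J :=
      integrable_finsetSum _ fun k _ => (muK_recursion k u v).1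
    have e3 : u * (dickman u - ∑ k ∈ Finset.range (K + 1), muK (k + 1) u v) =
        (∫ t in J, (dickman (u - t) - ∑ k ∈ Finset.range K, muK (k + 1) (u - t) v)) +
          (volume.real S - volume.real T) := by
      rw [mul_sub, e1, e2, integral_sub (hio.mono_set Set.inter_subset_left) hD]
      ring
    have hTS : T ⊆ S := fun t ht => ⟨ht.1, not_lt.2 ht.2.1.le⟩
    have e4 : |volume.real S - volume.real T| ≤ v := by
      rw [abs_of_nonneg (sub_nonneg.2 (measureReal_mono hTS hSfin)),
        ← measureReal_sdiff hTS hTm hSfin]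
      have hsub : S \ T ⊆ {u - 1} ∪ Set.Ico (u - v) u := by
        rintro t ⟨⟨ht, h1⟩, h2⟩
        have h1' : u - 1 ≤ t := not_lt.1 h1
        rcases h1'.eq_or_lt with h | h
        · exact Or.inl h.symm
        · refine Or.inr ⟨?_, by linarith [ht.2]⟩
          by_contra! h3
          exact h2 ⟨ht, h, h3⟩
      refine (ENNReal.toReal_le_of_le_ofReal hv ((measure_mono hsub).trans
        ((measure_union_le _ _).trans ?_)))
      simp
    have e5 := abs_setIntegral_le (f := fun t => dickman (u - t) -
      ∑ k ∈ Finset.range K, muK (k + 1) (u - t) v) K hB0 hv hu1 fun t ht => by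
        have h1 : 0 < t := ht.1.1
        have h2 : t < u - 1 := ht.2
        exact ih (u - t) ⟨by linarith, by linarith⟩
    have e6 : u * |dickman u - ∑ k ∈ Finset.range (K + 1), muK (k + 1) u v| ≤
        B * (u - 1) ^ (K + 1) / (K + 1).factorial + v * ((u ^ 2 - 1) / 2) + v := by
      rw [← abs_of_pos hu0, ← abs_mul, abs_of_pos hu0, e3]
      exact (abs_add_le _ _).trans (add_le_add e5 e4)
    have hp : 0 ≤ B * (u - 1) ^ (K + 1) / (K + 1).factorial :=
      div_nonneg (mul_nonneg hB0 (pow_nonneg (by linarith) _)) (by positivity)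
    refine le_of_mul_le_mul_left (e6.trans ?_) hu0
    have h7 : B * (u - 1) ^ (K + 1) / (K + 1).factorial ≤
      u * (B * (u - 1) ^ (K + 1) / (K + 1).factorial) := le_mul_of_one_le_left hp hu1
    have h8 : v * 1 ≤ v * u ^ 2 := mul_le_mul_of_nonneg_left (one_le_pow₀ hu1) hv
    linarith

theorem abs_dickman_sub_muSeries_le {u v : ℝ} (hu : 1 ≤ u) (hv : 0 ≤ v) :
    |dickman u - muSeries 1 u v| ≤ v * u := by
  obtain ⟨B, hB⟩ := (isCompact_Icc (a := (1 : ℝ)) (b := u)).exists_bound_of_continuousOn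
    continuous_dickman.continuousOn
  have hs := (summable_muTerm one_pos v hu).hasSum.tendsto_sum_nat
  have h1 : Tendsto (fun K : ℕ => |dickman u - ∑ k ∈ Finset.range K, 1 ^ (k + 1) *
      muK (k + 1) u v|) atTop (𝓝 |dickman u - muSeries 1 u v|) := (hs.const_sub _).abs
  have h2 : Tendsto (fun K : ℕ => B * ((u - 1) ^ K / K.factorial) + v * u) atTop
      (𝓝 (B * 0 + v * u)) :=
    ((FloorSemiring.tendsto_pow_div_factorial_atTop (u - 1)).const_mul B).add_const _
  rw [mul_zero, zero_add] at h2
  refine le_of_tendsto_of_tendsto' h1 h2 fun K => ?_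
  simp only [one_pow, one_mul]
  rw [← mul_div_assoc]
  exact abs_dickman_sub_sum_le hB hv K u ⟨hu, le_rfl⟩

theorem tendsto_rhoTheta_one {u : ℝ} (hu : 1 ≤ u) :
    Tendsto (fun θ : ℝ => rhoTheta θ 1 u) (𝓝[<] 1) (𝓝 (dickman u)) := by
  rw [tendsto_iff_dist_tendsto_zero]
  have h : Tendsto (fun θ : ℝ => (1 - θ) * u * u) (𝓝[<] 1) (𝓝 0) := by
    have : Tendsto (fun θ : ℝ => (1 - θ) * u * u) (𝓝 1) (𝓝 ((1 - 1) * u * u)) :=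
      Continuous.tendsto (by fun_prop) 1
    simp only [sub_self, zero_mul] at this
    exact this.mono_left nhdsWithin_le_nhds
  refine squeeze_zero' (Eventually.of_forall fun _ => dist_nonneg) ?_ h
  filter_upwards [self_mem_nhdsWithin] with θ hθ
  rw [dist_comm, Real.dist_eq]
  have : θ < 1 := hθ
  exact abs_dickman_sub_muSeries_le hu (mul_nonneg (by linarith) (by linarith))

/-! ### Primes in cells and the minorant for the friable count -/

/-- The tuples of primes whose logarithms to base `y` lie in the box with index `j`. -/
noncomputable def cellPrimes (y : ℝ) (N : ℕ) {k : ℕ} (j : Fin k → ℕ) : Finset (Fin k → ℕ) :=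
  Fintype.piFinset fun i =>
    (Finset.Ioc ⌊y ^ ((j i : ℝ) / N)⌋₊ ⌊y ^ (((j i : ℝ) + 1) / N)⌋₊).filter Nat.Prime

theorem mem_Ioc_floor_rpow_iff {y : ℝ} (hy : 1 < y) {a b : ℝ} {q : ℕ} (hq : 0 < q) :
    q ∈ Finset.Ioc ⌊y ^ a⌋₊ ⌊y ^ b⌋₊ ↔ Real.log q / Real.log y ∈ Set.Ioc a b := by
  have hl := Real.log_pos hy
  have hy0 : 0 < y := by linarith
  have hq' : (0 : ℝ) < q := by exact_mod_cast hq
  rw [Finset.mem_Ioc, Nat.floor_lt (by positivity), Nat.le_floor_iff (by positivity), Set.mem_Ioc,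
    lt_div_iff₀ hl, div_le_iff₀ hl, ← Real.log_rpow hy0, ← Real.log_rpow hy0,
    Real.log_lt_log_iff (by positivity) hq', Real.log_le_log_iff hq' (by positivity)]

theorem mem_cellPrimes {y : ℝ} (hy : 1 < y) {N k : ℕ} {j : Fin k → ℕ} {p : Fin k → ℕ} :
    p ∈ cellPrimes y N j ↔ (∀ i, (p i).Prime) ∧ logRatio y p ∈ box N j := by
  simp only [cellPrimes, Fintype.mem_piFinset, Finset.mem_filter, box, Set.mem_univ_pi,
    ← forall_and]
  refine forall_congr' fun i => ?_
  rw [and_comm]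
  exact and_congr_right fun h => mem_Ioc_floor_rpow_iff hy h.pos

theorem disjoint_cellPrimes {y : ℝ} (hy : 1 < y) {N : ℕ} (hN : 0 < N) {k : ℕ} {j j' : Fin k → ℕ}
    (h : j ≠ j') : Disjoint (cellPrimes y N j) (cellPrimes y N j') := by
  rw [Finset.disjoint_left]
  exact fun p hp hp' => Set.disjoint_left.1 (disjoint_box hN h) ((mem_cellPrimes hy).1 hp).2
    ((mem_cellPrimes hy).1 hp').2

section GoodCell

variable {N M k : ℕ} {u v : ℝ} {j : Fin (k + 1) → ℕ}

theorem side_le_one (hj : j ∈ goodCells N M k u v) (i : Fin (k + 1)) :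
    ((j i : ℝ) + 1) / N ≤ 1 := by
  refine div_le_one_of_le₀ ?_ (by positivity)
  exact_mod_cast ((mem_goodCells.1 hj).1 i).2

theorem box_subset_simplexRegion (hj : j ∈ goodCells N M k u v) :
    box N j ⊆ simplexRegion (k + 1) (u - v) := fun s hs =>
  ⟨fun i => ⟨(by positivity : (0 : ℝ) ≤ j i / N).trans (hs i trivial).1.le,
    (hs i trivial).2.trans (side_le_one hj i)⟩,
    (Finset.sum_le_sum fun i _ => (hs i trivial).2).trans (mem_goodCells.1 hj).2.2.2.2⟩

theorem convex_box (N : ℕ) {k : ℕ} (j : Fin k → ℕ) : Convex ℝ (box N j) :=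
  convex_pi fun _ _ => convex_Ioc _ _

theorem cellWeight_nonneg (hj : j ∈ goodCells N M k u v) : 0 ≤ cellWeight N u j := by
  have h0 : ∀ i, (0 : ℝ) ≤ (j i : ℝ) / N := fun i => by positivity
  refine mul_nonneg (Finset.prod_nonneg fun i _ => h0 i) (stick_pos h0 ?_).le
  refine (Finset.sum_le_sum fun i _ => ?_).trans (mem_goodCells.1 hj).2.2.1
  gcongr; linarith

theorem cellWeight_le_one (hj : j ∈ goodCells N M k u v) : cellWeight N u j ≤ 1 := by
  have h0 : ∀ i, (0 : ℝ) ≤ (j i : ℝ) / N := fun i => by positivity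
  have h1 : ∀ i, (j i : ℝ) / N ≤ ((j i : ℝ) + 1) / N := fun i => by gcongr; linarith
  have hs := (Finset.sum_le_sum fun i _ => h1 (Fin.castSucc i)).trans (mem_goodCells.1 hj).2.2.1
  exact mul_le_one₀ (Finset.prod_le_one (fun i _ => h0 i) fun i _ =>
    (h1 i).trans (side_le_one hj i)) (stick_pos h0 hs).le (stick_le_one h0 hs)

theorem cellWeight_le_weight {y : ℝ} (hy : 1 < y) (hj : j ∈ goodCells N M k u v)
    {p : Fin (k + 1) → ℕ} (hp : p ∈ cellPrimes y N j) : cellWeight N u j ≤ weight y u p := by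
  have h0 : ∀ i, (0 : ℝ) ≤ (j i : ℝ) / N := fun i => by positivity
  have hb := ((mem_cellPrimes hy).1 hp).2
  have hs : ∑ i : Fin k, logRatio y p i.castSucc ≤ u - 1 :=
    (Finset.sum_le_sum fun i _ => (hb _ trivial).2).trans (mem_goodCells.1 hj).2.2.1
  have hle : ∀ i, (j i : ℝ) / N ≤ logRatio y p i := fun i => (hb i trivial).1.le
  refine mul_le_mul (Finset.prod_le_prod (fun i _ => h0 i) fun i _ => hle i)
    (stick_mono h0 hle hs) ?_ (Finset.prod_nonneg fun i _ => logRatio_nonneg hy p i)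
  exact (stick_pos h0 ((Finset.sum_le_sum fun i _ => hle _).trans hs)).le

theorem mem_stopTuples_of_mem_cellPrimes {y : ℝ} (hy : 1 < y) (hj : j ∈ goodCells N M k u v)
    {p : Fin (k + 1) → ℕ} (hp : p ∈ cellPrimes y N j) {n : ℕ} (hn : n ≠ 0)
    (hd : ∏ i, p i ∣ n) : p ∈ stopTuples n y u k ∧ ∀ i, (p i : ℝ) ≤ y := by
  obtain ⟨hpr, hb⟩ := (mem_cellPrimes hy).1 hp
  refine ⟨?_, fun i => ?_⟩
  · simp only [stopTuples, Finset.mem_filter, Fintype.mem_piFinset]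
    refine ⟨fun i => Nat.mem_primeFactors.2 ⟨hpr i, (Finset.dvd_prod_of_mem p
      (Finset.mem_univ i)).trans hd, hn⟩, hd,
      (Finset.sum_le_sum fun i _ => (hb _ trivial).2).trans (mem_goodCells.1 hj).2.2.1, ?_⟩
    exact (mem_goodCells.1 hj).2.2.2.1.trans_lt
      (Finset.sum_lt_sum_of_nonempty Finset.univ_nonempty fun i _ => (hb i trivial).1)
  · have h := (hb i trivial).2.trans (side_le_one hj i)
    rw [logRatio, div_le_one (Real.log_pos hy)] at h
    exact (Real.log_le_log_iff (by exact_mod_cast (hpr i).pos) (by linarith)).1 h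

end GoodCell

/-- After interchanging the sums, a friable `n` receives at most its total stopping weight, hence at
most `1`. A non-friable `n` receives nothing, since a cell tuple dividing it would be a stopping
tuple of primes `≤ y`. -/
theorem sum_cellWeight_mul_multCount_le {𝒜 : Finset ℕ} (h𝒜 : ∀ n ∈ 𝒜, 0 < n) {y : ℝ} (hy : 1 < y)
    {N : ℕ} (hN : 0 < N) (M K : ℕ) (v : ℝ) :
    ∑ k ∈ Finset.range K, ∑ j ∈ goodCells N M k (uParam 𝒜 y) v, cellWeight N (uParam 𝒜 y) j *
      ∑ p ∈ cellPrimes y N j, (multCount 𝒜 (∏ i, p i) : ℝ) ≤ friableCount 𝒜 y := by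
  classical
  set u := uParam 𝒜 y with hu
  have hnu : ∀ n ∈ 𝒜, Real.log n ≤ u * Real.log y := by
    intro n hn
    rw [hu, uParam, div_mul_cancel₀ _ (Real.log_pos hy).ne']
    refine Real.log_le_log (by exact_mod_cast h𝒜 n hn) ?_
    exact Nat.cast_le.2 (Finset.le_sup (f := id) hn)
  have hmult : ∀ d, (multCount 𝒜 d : ℝ) = ∑ n ∈ 𝒜, if d ∣ n then (1 : ℝ) else 0 := fun d => by
    rw [multCount, Finset.card_filter]; push_cast; rfl
  have hfri : (friableCount 𝒜 y : ℝ) =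
      ∑ n ∈ 𝒜, if (largestPrimeFactor n : ℝ) ≤ y then (1 : ℝ) else 0 := by
    rw [friableCount, Finset.card_filter]; push_cast; rfl
  have hswap : ∑ k ∈ Finset.range K, ∑ j ∈ goodCells N M k u v, cellWeight N u j *
      ∑ p ∈ cellPrimes y N j, (multCount 𝒜 (∏ i, p i) : ℝ) =
      ∑ n ∈ 𝒜, ∑ k ∈ Finset.range K, ∑ j ∈ goodCells N M k u v,
        ∑ p ∈ (cellPrimes y N j).filter (fun p => ∏ i, p i ∣ n), cellWeight N u j := by
    rw [Finset.sum_comm]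
    refine Finset.sum_congr rfl fun k _ => ?_
    rw [Finset.sum_comm]
    refine Finset.sum_congr rfl fun j _ => ?_
    simp only [hmult, Finset.sum_filter]
    rw [Finset.mul_sum, Finset.sum_comm]
    refine Finset.sum_congr rfl fun p _ => ?_
    rw [Finset.mul_sum]
    simp
  rw [hswap, hfri]
  refine Finset.sum_le_sum fun n hn => ?_
  have hn0 := (h𝒜 n hn).ne'
  split_ifs with hf
  · refine le_trans (Finset.sum_le_sum fun k _ => ?_) (sum_weight_stop_le hn0 hy (hnu n hn) K)
    calc ∑ j ∈ goodCells N M k u v,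
          ∑ p ∈ (cellPrimes y N j).filter (fun p => ∏ i, p i ∣ n), cellWeight N u j
        ≤ ∑ j ∈ goodCells N M k u v,
          ∑ p ∈ (cellPrimes y N j).filter (fun p => ∏ i, p i ∣ n), weight y u p :=
          Finset.sum_le_sum fun j hj => Finset.sum_le_sum fun p hp =>
            cellWeight_le_weight hy hj (Finset.mem_filter.1 hp).1
      _ = ∑ p ∈ (goodCells N M k u v).biUnion
            (fun j => (cellPrimes y N j).filter (fun p => ∏ i, p i ∣ n)), weight y u p :=
          (Finset.sum_biUnion fun j _ j' _ h => Finset.disjoint_filter_filter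
            (disjoint_cellPrimes hy hN h)).symm
      _ ≤ ∑ p ∈ stopTuples n y u k, weight y u p := by
          refine Finset.sum_le_sum_of_subset_of_nonneg (fun p hp => ?_) fun p hp _ => ?_
          · obtain ⟨j, hj, hp⟩ := Finset.mem_biUnion.1 hp
            obtain ⟨hp, hd⟩ := Finset.mem_filter.1 hp
            exact (mem_stopTuples_of_mem_cellPrimes hy hj hp hn0 hd).1
          · simp only [stopTuples, Finset.mem_filter] at hp
            exact mul_nonneg (Finset.prod_nonneg fun i _ => logRatio_nonneg hy p i)
              (stick_pos (logRatio_nonneg hy p) hp.2.2.1).le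
  · refine (Finset.sum_eq_zero fun k _ => Finset.sum_eq_zero fun j hj => ?_).le
    refine Finset.sum_eq_zero fun p hp => absurd ?_ hf
    obtain ⟨hp, hd⟩ := Finset.mem_filter.1 hp
    have := mem_stopTuples_of_mem_cellPrimes hy hj hp hn0 hd
    exact largestPrimeFactor_le_of_stop hn0 hy (hnu n hn) this.1 this.2

/-! ### Remainder sums over a cell -/

section Remainder

variable {N M k : ℕ} {u v : ℝ} {j : Fin (k + 1) → ℕ} {y : ℝ}

theorem injective_of_mem_cellPrimes (hy : 1 < y) (hN : 0 < N) (hj : Function.Injective j)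
    {p p' : Fin (k + 1) → ℕ} (hp : p ∈ cellPrimes y N j) (hp' : p' ∈ cellPrimes y N j)
    {i l : Fin (k + 1)} (h : p i = p' l) : i = l := by
  refine hj (eq_of_mem_cells hN (((mem_cellPrimes hy).1 hp).2 i trivial) ?_)
  have := ((mem_cellPrimes hy).1 hp').2 l trivial
  rwa [logRatio, ← h] at this

theorem prod_injOn_cellPrimes (hy : 1 < y) (hN : 0 < N) (hj : Function.Injective j) :
    Set.InjOn (fun p : Fin (k + 1) → ℕ => ∏ i, p i) (cellPrimes y N j) := by
  intro p hp p' hp' h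
  funext i
  have hpr := ((mem_cellPrimes hy).1 hp).1 i
  have hd : p i ∣ ∏ i, p' i := by
    rw [← show ∏ i, p i = ∏ i, p' i from h]
    exact Finset.dvd_prod_of_mem p (Finset.mem_univ i)
  obtain ⟨l, -, hl⟩ := (hpr.prime.dvd_finsetProd_iff _).1 hd
  have hl' := (Nat.prime_dvd_prime_iff_eq hpr (((mem_cellPrimes hy).1 hp').1 l)).1 hl
  rw [hl', injective_of_mem_cellPrimes hy hN hj hp hp' hl']

/-- Distinct indices force distinct primes, so `γ(d) / d` factors over the tuple and its sum over
the cell is a product of prime masses. -/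
theorem regionSum_box {𝒜 : Finset ℕ} {γ : ArithmeticFunction ℝ} (hγ : γ.IsMultiplicative)
    (X : ℝ) {a : ℤ} (ha : a ≠ 0) (hy : 1 < y) (hN : 0 < N) (hM : 0 < M)
    (hj : j ∈ goodCells N M k u v) (hay : (a.natAbs : ℝ) ≤ y ^ (1 / N : ℝ)) :
    regionSum 𝒜 γ X y a (k + 1) (box N j) =
      ∑ p ∈ cellPrimes y N j, remainder 𝒜 γ X (∏ i, p i) ∧
    regionSum 𝒜 γ X y a (k + 1) (box N j) =
      ∑ p ∈ cellPrimes y N j, (multCount 𝒜 (∏ i, p i) : ℝ) -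
        X * ∏ i, primeMass γ (y ^ ((j i : ℝ) / N)) (y ^ (((j i : ℝ) + 1) / N)) := by
  have h1 : regionSum 𝒜 γ X y a (k + 1) (box N j) =
      ∑ p ∈ cellPrimes y N j, remainder 𝒜 γ X (∏ i, p i) := by
    unfold regionSum
    refine Finset.sum_congr ?_ fun _ _ => rfl
    ext p
    rw [mem_cellPrimes hy]
    simp only [Finset.mem_filter, Fintype.mem_piFinset, Finset.mem_Icc]
    refine ⟨fun h => ⟨fun i => (h.1 i).2, h.2.1⟩, fun h => ?_⟩
    obtain ⟨hpr, hb⟩ := h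
    refine ⟨fun i => ⟨⟨(hpr i).one_le, Nat.le_floor ?_⟩, hpr i⟩, hb, fun i => ?_⟩
    · have h := (hb i trivial).2.trans (side_le_one hj i)
      rw [logRatio, div_le_one (Real.log_pos hy)] at h
      exact (Real.log_le_log_iff (by exact_mod_cast (hpr i).pos) (by linarith)).1 h
    · rw [Int.gcd_comm]
      -- Coprimality to `a` is automatic: indices are at least `M ≥ 1`, so each prime exceeds `y ^
      -- (1 / N) ≥ |a|` and cannot divide `a`.
      refine (Nat.Prime.coprime_iff_not_dvd (hpr i)).2 fun hd => ?_
      have hle : ((p i : ℕ) : ℝ) ≤ a.natAbs := by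
        exact_mod_cast Nat.le_of_dvd (Int.natAbs_pos.2 ha) hd
      have hlt : (1 : ℝ) / N < logRatio y p i := by
        refine lt_of_le_of_lt ?_ (hb i trivial).1
        gcongr
        exact_mod_cast hM.trans_le ((mem_goodCells.1 hj).1 i).1
      rw [logRatio, lt_div_iff₀ (Real.log_pos hy), ← Real.log_rpow (by linarith),
        Real.log_lt_log_iff (by positivity) (by exact_mod_cast (hpr i).pos)] at hlt
      linarith
  refine ⟨h1, ?_⟩
  rw [h1]
  simp only [remainder, Finset.sum_sub_distrib]
  congr 1
  simp only [primeMass]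
  rw [Finset.prod_univ_sum, Finset.mul_sum]
  refine Finset.sum_congr rfl fun p hp => ?_
  have hpr := ((mem_cellPrimes hy).1 hp).1
  rw [hγ.map_prod _ _ fun i _ l _ hil => (Nat.coprime_primes (hpr i) (hpr l)).2 fun h =>
    hil (injective_of_mem_cellPrimes hy hN (mem_goodCells.1 hj).2.1 hp hp h),
    Finset.prod_div_distrib, Nat.cast_prod]
  ring

/-- The product map is injective on a cell, so each `d ≤ y^{uθ}` occurs at most once and the full
sum of `|r_d|` dominates. -/
theorem abs_regionSum_box_le_of_condC {𝒜 : Finset ℕ} {γ : ArithmeticFunction ℝ}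
    (hγ : γ.IsMultiplicative) {X θ δ C : ℝ} (hy : 1 < y) (hN : 0 < N) (hM : 0 < M)
    (hj : j ∈ goodCells N M k (uParam 𝒜 y) ((1 - θ) * uParam 𝒜 y))
    (hC : CondC 𝒜 γ X y θ δ C) :
    |regionSum 𝒜 γ X y 1 (k + 1) (box N j)| ≤ C * (X / Real.log y ^ δ) := by
  classical
  have hy0 : 0 < y := by linarith
  rw [(regionSum_box hγ X one_ne_zero hy hN hM hj (by
    simpa using Real.one_le_rpow hy.le (by positivity))).1]
  refine ((Finset.abs_sum_le_sum_abs _ _).trans ?_).trans hC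
  rw [← Finset.sum_image (f := fun d => |remainder 𝒜 γ X d|)
    (prod_injOn_cellPrimes hy hN (mem_goodCells.1 hj).2.1)]
  refine Finset.sum_le_sum_of_subset_of_nonneg (fun d hd => ?_) fun _ _ _ => abs_nonneg _
  obtain ⟨p, hp, rfl⟩ := Finset.mem_image.1 hd
  obtain ⟨hpr, hb⟩ := (mem_cellPrimes hy).1 hp
  have hpos : 0 < ∏ i, p i := Finset.prod_pos fun i _ => (hpr i).pos
  refine Finset.mem_Icc.2 ⟨hpos, Nat.le_floor ?_⟩
  rw [← Real.log_le_log_iff (by exact_mod_cast hpos) (by positivity), Real.log_rpow hy0,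
    Nat.cast_prod, Real.log_prod fun i _ => by exact_mod_cast (hpr i).ne_zero]
  have hs := (box_subset_simplexRegion hj hb).2
  have : ∑ i, Real.log (p i) = (∑ i, logRatio y p i) * Real.log y := by
    rw [Finset.sum_mul]
    exact Finset.sum_congr rfl fun i _ => (div_mul_cancel₀ _ (Real.log_pos hy).ne').symm
  rw [this]
  exact mul_le_mul_of_nonneg_right (by linarith) (Real.log_pos hy).le

theorem abs_regionSum_box_le_of_condD {𝒜 : Finset ℕ} {γ : ArithmeticFunction ℝ}
    {X θ δ : ℝ} {a : ℤ} {C : ℕ → ℝ}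
    (hj : j ∈ goodCells N M k (uParam 𝒜 y) ((1 - θ) * uParam 𝒜 y))
    (hD : CondD 𝒜 γ X y θ δ a C) :
    |regionSum 𝒜 γ X y a (k + 1) (box N j)| ≤ C (k + 1) * (X / Real.log y ^ δ) := by
  refine hD (k + 1) (Nat.le_add_left 1 k) _ (convex_box N j) ?_
  refine (box_subset_simplexRegion hj).trans_eq ?_
  congr 1
  ring

end Remainder

/-! ### Assembly of the lower bound -/

/-- The tail of the series `μ^{(κ)}` is uniformly small for bounded `u`. -/
theorem exists_muSeries_le_sum_add {κ : ℝ} (hκ : 0 < κ) (u₀ : ℝ) {ε : ℝ} (hε : 0 < ε) :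
    ∃ K : ℕ, ∀ u v : ℝ, 1 ≤ u → u ≤ u₀ →
      muSeries κ u v ≤ ∑ k ∈ Finset.range K, κ ^ (k + 1) * muK (k + 1) u v + ε := by
  obtain ⟨c, hc⟩ : ∃ c : ℕ → ℝ, ∀ k, c k = κ * ((κ * u₀) ^ k / k.factorial) := ⟨_, fun _ => rfl⟩
  have hsum : Summable c := (summable_majorant κ u₀).congr fun k => (hc k).symm
  obtain ⟨K, hK⟩ := ((tendsto_sum_nat_add c).eventually_lt_const hε).exists
  refine ⟨K, fun u v hu hu₀ => ?_⟩
  have hs := summable_muTerm hκ v hu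
  rw [muSeries, ← hs.sum_add_tsum_nat_add K]
  refine add_le_add le_rfl (le_trans ?_ hK.le)
  exact Summable.tsum_le_tsum (fun k => (muTerm_le hκ v hu hu₀ (k + K)).trans_eq (hc _).symm)
    ((summable_nat_add_iff K).2 hs) ((summable_nat_add_iff K).2 hsum)

theorem muSeries_le {κ u u₀ : ℝ} (hκ : 0 < κ) (v : ℝ) (hu : 1 ≤ u) (hu₀ : u ≤ u₀) :
    muSeries κ u v ≤ ∑' k : ℕ, κ * ((κ * u₀) ^ k / k.factorial) :=
  Summable.tsum_le_tsum (muTerm_le hκ v hu hu₀) (summable_muTerm hκ v hu) (summable_majorant κ u₀)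

/-- The lower bound for `Ψ_𝒜(y)` in terms of `X`, from a bound for the remainder sums over good
cells. -/
theorem exists_le_friableCount {κ : ℝ} (hκ : 0 < κ) (A δ u₀ : ℝ) {a : ℤ} (ha : a ≠ 0)
    (C : ℕ → ℝ) (hδ : 0 < δ) {ε : ℝ} (hε : 0 < ε) :
    ∃ y₀ : ℝ, ∀ (𝒜 : Finset ℕ) (γ : ArithmeticFunction ℝ) (X y θ : ℝ),
      (∀ n ∈ 𝒜, 0 < n) → 0 < X → 1 < y → y₀ ≤ y → 1 ≤ uParam 𝒜 y → uParam 𝒜 y ≤ u₀ →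
      γ.IsMultiplicative → CondA γ κ A →
      (∀ N M k : ℕ, 0 < N → 0 < M →
        ∀ j ∈ goodCells N M k (uParam 𝒜 y) ((1 - θ) * uParam 𝒜 y),
          |regionSum 𝒜 γ X y a (k + 1) (box N j)| ≤ C k * (X / Real.log y ^ δ)) →
      (rhoTheta θ κ (uParam 𝒜 y) - ε) * X ≤ friableCount 𝒜 y := by
  have hε3 : 0 < ε / 3 := by positivity
  obtain ⟨K, hK⟩ := exists_muSeries_le_sum_add hκ u₀ hε3
  set σ := ∑ k ∈ Finset.range K, κ ^ (k + 1) with hσ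
  have hσ0 : 0 ≤ σ := Finset.sum_nonneg fun k _ => by positivity
  -- The loss `ε'` in each `μ_k` is multiplied by `κ ^ (k + 1)`; the total over `k < K` is at most
  -- `ε / 3`. The other thirds go to the tail of the series and to the remainders.
  set ε' := ε / 3 / (σ + 1) with hε'
  have hε'0 : 0 < ε' := by positivity
  have hσε : σ * ε' ≤ ε / 3 := by
    rw [hε', mul_div_assoc', div_le_iff₀ (by positivity)]
    nlinarith
  obtain ⟨M, hM, hM0⟩ := (((Finset.eventually_all (Finset.range K)).2 fun k _ =>
    eventually_muK_sub_le k hε'0).and (eventually_gt_atTop 0)).exists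
  set N := M * M with hN
  have hN0 : 0 < N := Nat.mul_pos hM0 hM0
  have hN' : (0 : ℝ) < N := by exact_mod_cast hN0
  -- There are boundedly many cells once `K` and `M` are fixed, so the remainders total at most `R X
  -- / (log y)^δ`.
  set R := ∑ k ∈ Finset.range K,
    ((Fintype.piFinset fun _ : Fin (k + 1) => Finset.Ico M N).card : ℝ) * |C k| with hR
  -- the conditions on `y`
  have hy1 : ∀ᶠ y : ℝ in atTop, ∀ i ∈ Finset.Ico M N, ∀ γ : ArithmeticFunction ℝ, CondA γ κ A →
      κ * (1 / ((i : ℝ) + 1)) ≤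
        primeMass γ (y ^ ((i : ℝ) / N)) (y ^ (((i : ℝ) + 1) / N)) := by
    refine (Finset.eventually_all _).2 fun i hi => ?_
    have hi0 : (0 : ℝ) < i := by
      exact_mod_cast hM0.trans_le (Finset.mem_Ico.1 hi).1
    have := eventually_le_primeMass hκ A (a := (i : ℝ) / N) (b := ((i : ℝ) + 1) / N)
      (by positivity) (by gcongr; linarith)
    -- The ratio `(b - a) / b` for the interval `(i/N, (i+1)/N]`, matching the factor in
    -- `eventually_muK_sub_le`.
    have he : (((i : ℝ) + 1) / N - (i : ℝ) / N) / (((i : ℝ) + 1) / N) = 1 / ((i : ℝ) + 1) := by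
      field_simp
      ring
    rwa [he] at this
  have hy2 : ∀ᶠ y : ℝ in atTop, (a.natAbs : ℝ) ≤ y ^ (1 / N : ℝ) :=
    (tendsto_rpow_atTop (by positivity)).eventually_ge_atTop _
  have hy3 : ∀ᶠ y : ℝ in atTop, R / Real.log y ^ δ < ε / 3 :=
    (tendsto_const_nhds.div_atTop
      ((tendsto_rpow_atTop hδ).comp Real.tendsto_log_atTop)).eventually_lt_const hε3
  obtain ⟨y₀, hy₀⟩ := eventually_atTop.1 (hy1.and (hy2.and hy3))
  refine ⟨y₀, fun 𝒜 γ X y θ h𝒜 hX hy hyy hu hu₀ hγ hA hreg => ?_⟩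
  obtain ⟨h1, h2, h3⟩ := hy₀ y hyy
  set u := uParam 𝒜 y with hudef
  set v := (1 - θ) * u with hv
  have hL : 0 < Real.log y ^ δ := Real.rpow_pos_of_pos (Real.log_pos hy) δ
  have hcell : ∀ k, ∀ j ∈ goodCells N M k u v,
      X * (κ ^ (k + 1) * (cellWeight N u j * ∏ i, 1 / ((j i : ℝ) + 1))) -
        |C k| * (X / Real.log y ^ δ) ≤
      cellWeight N u j * ∑ p ∈ cellPrimes y N j, (multCount 𝒜 (∏ i, p i) : ℝ) := by
    intro k j hj
    have e1 := (regionSum_box (𝒜 := 𝒜) hγ X ha hy hN0 hM0 hj h2).2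
    have e2 := (abs_le.1 ((hreg N M k hN0 hM0 j hj).trans
      (mul_le_mul_of_nonneg_right (le_abs_self _) (by positivity)))).1
    have e3 : κ ^ (k + 1) * ∏ i, 1 / ((j i : ℝ) + 1) ≤
        ∏ i, primeMass γ (y ^ ((j i : ℝ) / N)) (y ^ (((j i : ℝ) + 1) / N)) := by
      have : κ ^ (k + 1) = ∏ _i : Fin (k + 1), κ := by simp
      rw [this, ← Finset.prod_mul_distrib]
      exact Finset.prod_le_prod (fun i _ => by positivity) fun i _ =>
        h1 _ (Finset.mem_Ico.2 ((mem_goodCells.1 hj).1 i)) γ hA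
    have e4 : X * (κ ^ (k + 1) * ∏ i, 1 / ((j i : ℝ) + 1)) - |C k| * (X / Real.log y ^ δ) ≤
        ∑ p ∈ cellPrimes y N j, (multCount 𝒜 (∏ i, p i) : ℝ) := by
      have := mul_le_mul_of_nonneg_left e3 hX.le
      linarith
    have e5 := mul_le_mul_of_nonneg_left e4 (cellWeight_nonneg hj)
    have e6 : cellWeight N u j * (|C k| * (X / Real.log y ^ δ)) ≤ |C k| * (X / Real.log y ^ δ) :=
      mul_le_of_le_one_left (by positivity) (cellWeight_le_one hj)
    refine le_trans ?_ e5
    rw [mul_sub]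
    have e7 : X * (κ ^ (k + 1) * (cellWeight N u j * ∏ i, 1 / ((j i : ℝ) + 1))) =
      cellWeight N u j * (X * (κ ^ (k + 1) * ∏ i, 1 / ((j i : ℝ) + 1))) := by ring
    linarith
  have hk : ∀ k ∈ Finset.range K,
      X * (κ ^ (k + 1) * muK (k + 1) u v) - X * (κ ^ (k + 1) * ε') -
        ((Fintype.piFinset fun _ : Fin (k + 1) => Finset.Ico M N).card : ℝ) * |C k| *
          (X / Real.log y ^ δ) ≤
      ∑ j ∈ goodCells N M k u v,
        cellWeight N u j * ∑ p ∈ cellPrimes y N j, (multCount 𝒜 (∏ i, p i) : ℝ) := by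
    intro k hkK
    refine le_trans ?_ (Finset.sum_le_sum fun j hj => hcell k j hj)
    rw [Finset.sum_sub_distrib, ← Finset.mul_sum, ← Finset.mul_sum, Finset.sum_const, nsmul_eq_mul]
    have f1 := mul_le_mul_of_nonneg_left (hM k hkK u v hu) (by positivity : 0 ≤ X * κ ^ (k + 1))
    have f2 : ((goodCells N M k u v).card : ℝ) ≤
        ((Fintype.piFinset fun _ : Fin (k + 1) => Finset.Ico M N).card : ℝ) := by
      exact_mod_cast Finset.card_le_card (Finset.filter_subset _ _)
    have f3 := mul_le_mul_of_nonneg_right f2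
      (by positivity : 0 ≤ |C k| * (X / Real.log y ^ δ))
    rw [mul_sub] at f1
    linarith
  have htot := (Finset.sum_le_sum hk).trans
    (sum_cellWeight_mul_multCount_le h𝒜 hy hN0 M K v)
  rw [Finset.sum_sub_distrib, Finset.sum_sub_distrib, ← Finset.mul_sum, ← Finset.mul_sum,
    ← Finset.sum_mul, ← Finset.sum_mul, ← hσ, ← hR] at htot
  have g1 : R * (X / Real.log y ^ δ) ≤ X * (ε / 3) := by
    have : R * (X / Real.log y ^ δ) = X * (R / Real.log y ^ δ) := by ring
    rw [this]
    exact mul_le_mul_of_nonneg_left h3.le hX.le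
  have g2 := mul_le_mul_of_nonneg_left hσε hX.le
  have g3 := mul_le_mul_of_nonneg_left (hK u v hu hu₀) hX.le
  have g4 : rhoTheta θ κ u = muSeries κ u v := rfl
  rw [g4]
  linarith

/-- Replacing `X` by the cardinality in the lower bound. -/
theorem sub_mul_card_le {ρ ε τ R X c Ψ : ℝ} (hρR : ρ ≤ R) (hτR : τ * R ≤ ε / 2) (hτ : 0 ≤ τ)
    (hε : 0 < ε) (hX : 0 < X) (hc : 0 ≤ c) (hcX : c ≤ (1 + τ) * X) (hΨ : 0 ≤ Ψ)
    (h : (ρ - ε / 2) * X ≤ Ψ) : (ρ - ε) * c ≤ Ψ := by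
  -- If `ρ ≤ ε` the left side is nonpositive; otherwise the upper bound on the cardinality may be
  -- multiplied by `ρ - ε ≥ 0`.
  rcases le_total ρ ε with h1 | h1
  · exact (mul_nonpos_of_nonpos_of_nonneg (by linarith) hc).trans hΨ
  · have h2 := mul_le_mul_of_nonneg_left hcX (sub_nonneg.2 h1)
    have h3 : τ * (ρ - ε) ≤ ε / 2 := (mul_le_mul_of_nonneg_left (by linarith) hτ).trans hτR
    have h4 := mul_le_mul_of_nonneg_right h3 hX.le
    nlinarith

/-- As `y = x^{1/u}` with `u` bounded, a large `x` forces a large `y`. -/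
theorem le_of_exp_le_supElt {𝒜 : Finset ℕ} {y y₀ u₀ : ℝ} (hy₀ : 1 ≤ y₀) (hy : 1 < y)
    (hx : Real.exp (u₀ * Real.log y₀) ≤ supElt 𝒜) (hu : 1 ≤ uParam 𝒜 y) (hu₀ : uParam 𝒜 y ≤ u₀) :
    y₀ ≤ y := by
  have hl := Real.log_pos hy
  have h1 : u₀ * Real.log y₀ ≤ Real.log (supElt 𝒜) :=
    (Real.le_log_iff_exp_le ((Real.exp_pos _).trans_le hx)).2 hx
  have h2 : Real.log (supElt 𝒜) ≤ u₀ * Real.log y := by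
    rw [uParam, div_le_iff₀ hl] at hu₀
    exact hu₀
  have h3 := le_of_mul_le_mul_left (h1.trans h2) (by linarith)
  exact (Real.log_le_log_iff (by linarith) (by linarith)).1 h3

theorem exists_le_friableCount_card {κ : ℝ} (hκ : 0 < κ) (A δ u₀ : ℝ) {a : ℤ} (ha : a ≠ 0)
    (C : ℕ → ℝ) (hδ : 0 < δ) {ε : ℝ} (hε : 0 < ε) :
    ∃ τ > 0, ∃ y₀ ≥ 1, ∀ (𝒜 : Finset ℕ) (γ : ArithmeticFunction ℝ) (X y θ : ℝ),
      (∀ n ∈ 𝒜, 0 < n) → 0 < X → 1 < y → y₀ ≤ y → 1 ≤ uParam 𝒜 y → uParam 𝒜 y ≤ u₀ →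
      γ.IsMultiplicative → CondA γ κ A →
      (∀ N M k : ℕ, 0 < N → 0 < M →
        ∀ j ∈ goodCells N M k (uParam 𝒜 y) ((1 - θ) * uParam 𝒜 y),
          |regionSum 𝒜 γ X y a (k + 1) (box N j)| ≤ C k * (X / Real.log y ^ δ)) →
      |(𝒜.card : ℝ) - X| ≤ τ * X →
      (rhoTheta θ κ (uParam 𝒜 y) - ε) * (𝒜.card : ℝ) ≤ friableCount 𝒜 y := by
  obtain ⟨y₀, h⟩ := exists_le_friableCount hκ A δ u₀ ha C hδ (half_pos hε)
  set R := ∑' k : ℕ, κ * ((κ * u₀) ^ k / k.factorial) with hR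
  -- The coefficient is bounded by `R` uniformly for `u ≤ u₀`, so this relative error between `X`
  -- and the cardinality costs at most `ε / 2`.
  refine ⟨ε / 2 / (|R| + 1), by positivity, max y₀ 1, le_max_right _ _,
    fun 𝒜 γ X y θ h𝒜 hX hy hyy hu hu₀ hγ hA hreg hc => ?_⟩
  have h1 := h 𝒜 γ X y θ h𝒜 hX hy ((le_max_left _ _).trans hyy) hu hu₀ hγ hA hreg
  refine sub_mul_card_le (R := R) (τ := ε / 2 / (|R| + 1)) (muSeries_le hκ _ hu hu₀) ?_
    (by positivity) hε hX (Nat.cast_nonneg _) ?_ (Nat.cast_nonneg _) h1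
  · rw [div_mul_eq_mul_div, div_le_iff₀ (by positivity)]
    exact mul_le_mul_of_nonneg_left (by linarith [le_abs_self R]) (by positivity)
  · linarith [(abs_le.1 hc).2]

end Friable

open Friable
theorem mainTheorem1 (κ : ℝ) (hκ : 0 < κ) :
    -- the series defining the coefficient converges, and the coefficient is positive
    (∀ θ u : ℝ, 0 < θ → θ < 1 → 1 ≤ u → (1 - θ) * u < 1 →
      Summable (fun k : ℕ => κ ^ (k + 1) * muK (k + 1) u ((1 - θ) * u)) ∧
        0 < rhoTheta θ κ u) ∧
    -- lower bound under the condition with absolute values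
    (∀ A B δ C u₀ ε : ℝ, 0 < δ → 0 < ε →
      ∃ x₀ : ℝ, ∀ (𝒜 : Finset ℕ) (γ : ArithmeticFunction ℝ) (X y θ : ℝ),
        𝒜.Nonempty → (∀ n ∈ 𝒜, 0 < n) → 0 < X → 1 < y → 0 < θ → θ < 1 →
        x₀ ≤ supElt 𝒜 → 1 ≤ uParam 𝒜 y → uParam 𝒜 y ≤ u₀ → (1 - θ) * uParam 𝒜 y < 1 →
        γ.IsMultiplicative → CondA γ κ A → CondB γ B → CondC 𝒜 γ X y θ δ C →
          (rhoTheta θ κ (uParam 𝒜 y) - ε) * (𝒜.card : ℝ) ≤ (friableCount 𝒜 y : ℝ)) ∧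
    -- the same lower bound under the condition without absolute values
    (∀ (A B δ u₀ ε : ℝ) (a : ℤ) (C : ℕ → ℝ) (η : ℝ → ℝ), 0 < δ → 0 < ε → a ≠ 0 →
      Tendsto η atTop (𝓝 0) →
      ∃ x₀ : ℝ, ∀ (𝒜 : Finset ℕ) (γ : ArithmeticFunction ℝ) (X y θ : ℝ),
        𝒜.Nonempty → (∀ n ∈ 𝒜, 0 < n) → 0 < X → 1 < y → 0 < θ → θ < 1 →
        x₀ ≤ supElt 𝒜 → 1 ≤ uParam 𝒜 y → uParam 𝒜 y ≤ u₀ → (1 - θ) * uParam 𝒜 y < 1 →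
        γ.IsMultiplicative → CondA γ κ A → CondB γ B → CondD 𝒜 γ X y θ δ a C →
        |(𝒜.card : ℝ) - X| ≤ η (supElt 𝒜) * X →
          (rhoTheta θ κ (uParam 𝒜 y) - ε) * (𝒜.card : ℝ) ≤ (friableCount 𝒜 y : ℝ)) ∧
    -- for `κ = 1`, convergence to the Dickman function
    (∀ u : ℝ, 1 ≤ u → Tendsto (fun θ : ℝ => rhoTheta θ 1 u) (𝓝[<] 1) (𝓝 (dickman u))) := by
  refine ⟨fun θ u _ _ hu hv => ⟨summable_muTerm hκ _ hu, muSeries_pos hκ hu hv⟩, ?_, ?_,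
    fun u hu => tendsto_rhoTheta_one hu⟩
  · intro A B δ C u₀ ε hδ hε
    obtain ⟨τ, hτ, y₀, hy₀, h⟩ :=
      exists_le_friableCount_card hκ A δ u₀ (a := 1) one_ne_zero (fun _ => C) hδ hε
    have hlim : Tendsto (fun y : ℝ => C / Real.log y ^ δ) atTop (𝓝 0) :=
      tendsto_const_nhds.div_atTop ((tendsto_rpow_atTop hδ).comp Real.tendsto_log_atTop)
    obtain ⟨y₁, hy₁⟩ := eventually_atTop.1 (hlim.eventually_lt_const hτ)
    refine ⟨Real.exp (u₀ * Real.log (max y₀ y₁)), fun 𝒜 γ X y θ _ h𝒜 hX hy hθ _ hx hu hu₀ _ hγ hA _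
      hC => ?_⟩
    have hyy := le_of_exp_le_supElt (hy₀.trans (le_max_left _ _)) hy hx hu hu₀
    refine h 𝒜 γ X y θ h𝒜 hX hy ((le_max_left _ _).trans hyy) hu hu₀ hγ hA
      (fun N M k hN hM j hj => abs_regionSum_box_le_of_condC hγ hy hN hM hj hC) ?_
    -- The term `d = 1` of `(C_θ)` compares the cardinality with `X`, since `r_1` is their
    -- difference.
    have h1 : |remainder 𝒜 γ X 1| ≤ C * (X / Real.log y ^ δ) := by
      refine le_trans (Finset.single_le_sum (f := fun d => |remainder 𝒜 γ X d|)
        (fun _ _ => abs_nonneg _) (Finset.mem_Icc.2 ⟨le_rfl, Nat.le_floor ?_⟩)) hC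
      simpa using Real.one_le_rpow hy.le (mul_nonneg (by linarith) hθ.le)
    have h2 : remainder 𝒜 γ X 1 = (𝒜.card : ℝ) - X := by
      simp [remainder, multCount, hγ.map_one]
    rw [← h2]
    refine h1.trans ?_
    have h3 := mul_le_mul_of_nonneg_right (hy₁ y ((le_max_right _ _).trans hyy)).le hX.le
    refine le_trans (le_of_eq ?_) h3
    ring
  · intro A B δ u₀ ε a C η hδ hε ha hη
    obtain ⟨τ, hτ, y₀, hy₀, h⟩ :=
      exists_le_friableCount_card hκ A δ u₀ ha (fun k => C (k + 1)) hδ hε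
    obtain ⟨x₁, hx₁⟩ := eventually_atTop.1 (hη.eventually_lt_const hτ)
    refine ⟨max x₁ (Real.exp (u₀ * Real.log y₀)), fun 𝒜 γ X y θ _ h𝒜 hX hy _ _ hx hu hu₀ _ hγ hA _
      hD hc => ?_⟩
    have hyy := le_of_exp_le_supElt hy₀ hy ((le_max_right _ _).trans hx) hu hu₀
    refine h 𝒜 γ X y θ h𝒜 hX hy hyy hu hu₀ hγ hA
      (fun N M k _ _ j hj => abs_regionSum_box_le_of_condD hj hD) (hc.trans ?_)
    exact mul_le_mul_of_nonneg_right (hx₁ _ ((le_max_left _ _).trans hx)).le hX.le
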